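/- Let $\mathbb K$ be an algebraically closed field, let $0<p<q$ be coprime integers, and let $\sigma\subset N_{\mathbb R}=\mathbb R^2$ be the cone generated by $(1,0)$ and $(p,q)$. Let $S=\operatorname{Spec}\mathbb K[\sigma^\vee\cap M]$ be the corresponding affine toric surface, where $M=\mathbb Z^2$ is the dual lattice of $N=\mathbb Z^2$. Let $(c_2,\dots,c_{e-1})$, all $c_i\ge 2$, be the entries of the Hirzebruch–Jung continued fraction $$\frac qp=c_2-\cfrac{1}{c_3-\cfrac{1}{\ddots-\cfrac1{c_{e-1}}}},$$ so that $e$ is the embedding dimension of $S$, and assume $e>3$. Let $u_1,\dots,u_e$ be the minimal generators of the semigroup $\sigma^\vee\cap M$, ordered along the boundary of the convex hull of its nonzero elements from $(0,1)$ to $(q,-p)$ (equivalently, by increasing first coordinate), and embed $S$ in $\mathbb A^e=\operatorname{Spec}\mathbb K[x_1,\dots,x_e]$ by $x_j=\chi^{u_j}$. For $m\in\mathbb N$ let $\mathbb A^e_m=\operatorname{Spec}\mathbb K[x_j^{(b)};\,1\le j\le e,\ 0\le b\le m]$ be the space of $m$-jets $x_j(t)=\sum_{b\le m}x_j^{(b)}t^b$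 of $\mathbb A^e$, and let $S_m\subset\mathbb A^e_m$ be the $m$-jet scheme of $S$. For $f\in\mathbb K[x_1,\dots,x_e]$ and $r\le m$ let $\mathrm{Cont}^r(f)_m$ be the set of $\gamma\in S_m$ such that the $t$-order of $f\circ\gamma$ is $r$. For $2\le i\le e-1$, $1\le s\le\lceil m/2\rceil$ and $s\le l\le\min\{(c_i-1)s,\ (m+1)-s\}$ put $$D_{i,m}^{s,l}=\mathrm{Cont}^s(x_i)_m\cap \mathrm{Cont}^l(x_{i+1})_m,\qquad C_{i,m}^{s,l}=\overline{D_{i,m}^{s,l}}.$$ Then $C_{i,m}^{s,l}$ is irreducible, and its codimension in $\mathbb A^e_m$ is $$se+(m-(2s-1))(e-2).$$ Moreover, the coordinate ring of $D_{i,m}^{s,l}$ (with its reduced structure; it is closed in the affine open subset $x_i^{(s)}x_{i+1}^{(l)}\ne0$ of $\mathbb A^e_m$) is a polynomial ring in finitely many variables over $\mathbb K[x_i^{(s)},x_{i+1}^{(l)}]_{x_i^{(s)}x_{i+1}^{(l)}}$, the localization of a polynomial ring in two variables; that is, it is isomorphic as a $\mathbb K$-algebra to a polynomial ring over $\mathbb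 K[a,b]_{ab}$ by an isomorphism that sends $x_i^{(s)}\mapsto a$ and $x_{i+1}^{(l)}\mapsto b$. -/

import Mathlib

noncomputable section

namespace ToricJets

open MvPolynomial TopologicalSpace

/-! ### The toric surface -/

/-- The cone `σ` in `N_ℝ = ℝ²` generated by `(1, 0)` and `(p, q)`. -/
def cone (p q : ℕ) : PointedCone ℝ (ℝ × ℝ) :=
  PointedCone.hull ℝ {((1 : ℝ), (0 : ℝ)), ((p : ℝ), (q : ℝ))}

/-- The semigroup `σ^∨ ∩ M`, where the lattice `M = ℤ²` is paired with `N_ℝ = ℝ²` by the standard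
pairing. -/
def dualSemigroup (p q : ℕ) : AddSubmonoid (ℤ × ℤ) where
  carrier := {w | ∀ v ∈ cone p q, 0 ≤ (w.1 : ℝ) * v.1 + (w.2 : ℝ) * v.2}
  zero_mem' := by
    intro v _
    simp
  add_mem' := by
    intro a b ha hb v hv
    have h1 := ha v hv
    have h2 := hb v hv
    simp only [Prod.fst_add, Prod.snd_add, Int.cast_add]
    nlinarith

/-- `u` lists the minimal system of generators of the semigroup `σ^∨ ∩ M`, ordered along the
boundary of the convex hull of its nonzero elements, from `(0, 1)` to `(q, -p)`. -/
structure IsMinimalGenerators {e : ℕ} (p q : ℕ) (u : Fin e → ℤ × ℤ) : Prop where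
  isLeast : IsLeast {G : Set (ℤ × ℤ) | AddSubmonoid.closure G = dualSemigroup p q} (Set.range u)
  strictMono : StrictMono fun j => (u j).1

/-- The ideal in `K[x_1, …, x_e]` of the toric surface `S = Spec K[σ^∨ ∩ M]`, embedded in `𝔸^e` by
`x_j = χ^{u_j}`: the kernel of `K[x_1, …, x_e] → K[M]`, `x_j ↦ χ^{u_j}`. -/
def toricIdeal (K : Type*) [Field K] {e : ℕ} (u : Fin e → ℤ × ℤ) : Ideal (MvPolynomial (Fin e) K) :=
  RingHom.ker (aeval (fun j => AddMonoidAlgebra.single (u j) (1 : K)) :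
    MvPolynomial (Fin e) K →ₐ[K] AddMonoidAlgebra K (ℤ × ℤ))

/-- The value `a₁ - 1/(a₂ - 1/(a₃ - ⋯))` of a Hirzebruch-Jung continued fraction. -/
def hjValue : List ℕ → ℚ
  | [] => 0
  | [a] => a
  | a :: b :: L => a - 1 / hjValue (b :: L)

/-- `c` lists the entries (all at least two) of the Hirzebruch-Jung continued fraction of `q/p`. -/
structure IsHirzebruchJung {n : ℕ} (p q : ℕ) (c : Fin n → ℕ) : Prop where
  two_le : ∀ k, 2 ≤ c k
  value : hjValue (List.ofFn c) = (q : ℚ) / p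

/-! ### Jet schemes -/

section Jets

variable (K : Type*) [Field K] (e m : ℕ)

/-- The coordinate ring of the jet space `𝔸^e_m`; the variable `(j, b)` is `x_j^{(b)}`. -/
abbrev JetRing : Type _ := MvPolynomial (Fin e × Fin (m + 1)) K

/-- The universal jet `x_j ↦ ∑_{b ≤ m} x_j^{(b)} t^b`. Only its class modulo `t^{m+1}` matters. -/
def universalJet : MvPolynomial (Fin e) K →ₐ[K] Polynomial (JetRing K e m) :=
  aeval fun j => ∑ b : Fin (m + 1), Polynomial.monomial (b : ℕ) (X (j, b) : JetRing K e m)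

variable {K e}

/-- The coefficient of `t^b` in `f ∘ γ`, for the universal `m`-jet `γ` and `b ≤ m`. -/
def jetCoeff (f : MvPolynomial (Fin e) K) (b : ℕ) : JetRing K e m :=
  (universalJet K e m f).coeff b

/-- The ideal of the `m`-jet scheme of `V(I)` in `𝔸^e_m`: the condition is `f ∘ γ ≡ 0` modulo
`t^{m+1}` for all `f ∈ I`. -/
def jetIdeal (I : Ideal (MvPolynomial (Fin e) K)) : Ideal (JetRing K e m) :=
  Ideal.span {g | ∃ f ∈ I, ∃ b ≤ m, g = jetCoeff m f b}

/-- `Cont^r(f)_m`, for `r ≤ m`: the points `γ` of the `m`-jet scheme of `V(I)` with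
`ord_γ(f) = r`. A coefficient of `f ∘ γ`, which lies in the residue field of the point `γ`, vanishes
exactly when the corresponding element of the coordinate ring lies in the prime ideal of `γ`. -/
def contact (I : Ideal (MvPolynomial (Fin e) K)) (f : MvPolynomial (Fin e) K) (r : ℕ) :
    Set (PrimeSpectrum (JetRing K e m)) :=
  {γ | γ ∈ PrimeSpectrum.zeroLocus (jetIdeal m I : Set (JetRing K e m)) ∧
    (∀ b < r, jetCoeff m f b ∈ γ.asIdeal) ∧ jetCoeff m f r ∉ γ.asIdeal}

end Jets

/-- The codimension of an irreducible closed subset `Z` of `X`: the supremum of the lengths of the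
chains `Z = Z₀ ⊂ Z₁ ⊂ ⋯ ⊂ Z_d` of irreducible closed subsets of `X`. -/
def codim {X : Type*} [TopologicalSpace X] (Z : IrreducibleCloseds X) : ℕ∞ :=
  Order.coheight Z

/-! ### The loci `D` and `C`

There are `n = e - 2` continued fraction entries `c_2, …, c_{e-1}`, indexed by `Fin n`, and `e = n + 2`
variables `x_1, …, x_e`, indexed by `Fin (n + 2)`. If `i : Fin n` is the position of the entry `c_i`,
then the position of `x_i` is `i.castSucc.succ` (the number `i + 1`) and that of `x_{i+1}` is
`i.succ.succ` (the number `i + 2`). -/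

section Loci

variable (K : Type*) [Field K] {n : ℕ} (u : Fin (n + 2) → ℤ × ℤ) (i : Fin n) (m s l : ℕ)

/-- `D_{i,m}^{s,l} = Cont^s(x_i)_m ∩ Cont^l(x_{i+1})_m`. -/
def D : Set (PrimeSpectrum (JetRing K (n + 2) m)) :=
  contact m (toricIdeal K u) (X i.castSucc.succ) s ∩ contact m (toricIdeal K u) (X i.succ.succ) l

/-- `C_{i,m}^{s,l}`, the closure of `D_{i,m}^{s,l}`. -/
def C : Set (PrimeSpectrum (JetRing K (n + 2) m)) :=
  closure (D K u i m s l)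

/-- The coordinate `x_i^{(s)}`. -/
def coordA : JetRing K (n + 2) m := jetCoeff m (X i.castSucc.succ) s

/-- The coordinate `x_{i+1}^{(l)}`. -/
def coordB : JetRing K (n + 2) m := jetCoeff m (X i.succ.succ) l

/-- `D_{i,m}^{s,l}` is closed in the affine open subset `D(x_i^{(s)} x_{i+1}^{(l)})` of `𝔸^e_m`. -/
theorem D_eq_C_inter_basicOpen :
    D K u i m s l = C K u i m s l ∩
      (PrimeSpectrum.basicOpen (coordA K i m s * coordB K i m l) :
        Set (PrimeSpectrum (JetRing K (n + 2) m))) := by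
  set Z : Set (PrimeSpectrum (JetRing K (n + 2) m)) := PrimeSpectrum.zeroLocus
    ((jetIdeal m (toricIdeal K u) : Set (JetRing K (n + 2) m)) ∪
      ({g | ∃ b < s, g = jetCoeff m (X i.castSucc.succ) b} ∪
        {g | ∃ b < l, g = jetCoeff m (X i.succ.succ) b})) with hZ
  have key : D K u i m s l = Z ∩
      (PrimeSpectrum.basicOpen (coordA K i m s * coordB K i m l) :
        Set (PrimeSpectrum (JetRing K (n + 2) m))) := by
    ext γ
    simp only [D, contact, hZ, PrimeSpectrum.zeroLocus_union, Set.mem_inter_iff, Set.mem_ofPred_eq,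
      PrimeSpectrum.mem_zeroLocus, SetLike.mem_coe, PrimeSpectrum.mem_basicOpen,
      γ.isPrime.mul_mem_iff_mem_or_mem, coordA, coordB, Set.subset_def]
    grind
  apply Set.Subset.antisymm
  · intro γ hγ
    exact ⟨subset_closure hγ, by rw [key] at hγ; exact hγ.2⟩
  · rintro γ ⟨h1, h2⟩
    rw [key]
    refine ⟨?_, h2⟩
    have hcl : IsClosed Z := PrimeSpectrum.isClosed_zeroLocus _
    refine closure_minimal ?_ hcl h1
    rw [key]
    exact Set.inter_subset_left

/-- The coordinate ring of the (reduced, locally closed, affine) variety `D_{i,m}^{s,l}`: it is closed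
in the affine open subset `D(x_i^{(s)} x_{i+1}^{(l)})`, so its coordinate ring is the localization at
`x_i^{(s)} x_{i+1}^{(l)}` of the quotient by the ideal of functions vanishing on it. -/
abbrev coordRing : Type _ :=
  Localization.Away (Ideal.Quotient.mk (PrimeSpectrum.vanishingIdeal (D K u i m s l))
    (coordA K i m s * coordB K i m l))

/-- The restriction of functions from `𝔸^e_m` to `D_{i,m}^{s,l}`. -/
def restrict (g : JetRing K (n + 2) m) : coordRing K u i m s l :=
  algebraMap (JetRing K (n + 2) m ⧸ PrimeSpectrum.vanishingIdeal (D K u i m s l)) _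
    (Ideal.Quotient.mk _ g)

end Loci

/-- The localized polynomial ring `K[a, b]_{ab}` in two variables. -/
abbrev TwoVarLoc (K : Type*) [Field K] : Type _ :=
  Localization.Away (X 0 * X 1 : MvPolynomial (Fin 2) K)

end ToricJets

end

/-! The generators satisfy u_{i-1} + u_{i+1} = c_i u_i, and for |i - j| ≥ 2 the sum u_i + u_j is a
combination of generators strictly between them. On `D` the series x_i and x_{i+1} are t^s and t^l
times units. Hence x_{i-1} x_{i+1} = x_i^{c_i} determines x_{i-1} modulo t^{m+1-l}, and the
relations of x_i x_j with monomials in intermediate variables determine every other x_j modulo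
t^{m+1-s}, by induction on the distance from i. The remaining coefficients, those of degree at least
`freeFrom`, are the only possible parameters (`jet_unique`).

They are indeed free (`exists_jet`). Put T = x_i, S = x_{i+1}. Since l ≤ (c_i - 1)s, the quotient
T^{c_i}/S is a power series of order at least s, and x_{i-1} is chosen congruent to it modulo
t^{m+1-l}. With ρ = S/T and π = x_{i-1}/T, the relation T^{c_i-2} = ρπ holds modulo t^{m+1-2s}.
Convexity writes u_j as d u_i + a(u_{i+1} - u_i) + b(u_{i-1} - u_i) with d ≥ 1 and a, b ≥ 0, so x_j
is taken to be T·T^{d-1}ρ^aπ^b modulo t^{m+1-s}. In a binomial of the toric ideal whose two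
monomials have degree at least two, both are divisible by T², and the cofactors agree modulo
t^{m+1-2s}; so it vanishes modulo t^{m+1} (`dvd_prod_sub_prod`). Minimality of the generators
excludes nontrivial binomials with a monomial of degree at most one.

Thus `D` is the graph of a morphism from the open set ab ≠ 0 in the affine space of free
coefficients (`exists_parametrization`). This gives irreducibility and the coordinate ring, and the
codimension is the number of coefficients that are not free (`height_ker_le`, `le_height_ker`,
`card_not_free`). -/

namespace ToricJets

/-! ### The dual semigroup and the vectors built from the continued fraction -/

theorem mem_dualSemigroup {p q : ℕ} {w : ℤ × ℤ} :
    w ∈ dualSemigroup p q ↔ 0 ≤ w.1 ∧ 0 ≤ p * w.1 + q * w.2 := by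
  change (∀ v ∈ cone p q, 0 ≤ (w.1 : ℝ) * v.1 + (w.2 : ℝ) * v.2) ↔ _
  constructor
  · intro h
    have h1 := h (1, 0) (Submodule.subset_span (by simp))
    have h2 := h (p, q) (Submodule.subset_span (by simp))
    simp only at h1 h2
    constructor
    · have : (0 : ℝ) ≤ (w.1 : ℝ) := by linarith
      exact_mod_cast this
    · have : (0 : ℝ) ≤ (p : ℝ) * (w.1 : ℝ) + q * (w.2 : ℝ) := by linarith
      exact_mod_cast this
  · rintro ⟨h1, h2⟩ v hv
    have h1' : (0 : ℝ) ≤ (w.1 : ℝ) := by exact_mod_cast h1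
    have h2' : (0 : ℝ) ≤ (p : ℝ) * (w.1 : ℝ) + q * (w.2 : ℝ) := by exact_mod_cast h2
    obtain ⟨a, b, rfl⟩ := Submodule.mem_span_pair.1 hv
    have ha : (0 : ℝ) ≤ a := a.2
    have hb : (0 : ℝ) ≤ b := b.2
    have := mul_nonneg ha h1'
    have := mul_nonneg hb h2'
    simp only [Prod.fst_add, Prod.snd_add, Prod.smul_fst, Prod.smul_snd,
      smul_eq_mul, ← Nonneg.coe_smul]
    change 0 ≤ (w.1 : ℝ) * ((a : ℝ) * 1 + (b : ℝ) * p) + (w.2 : ℝ) * ((a : ℝ) * 0 + (b : ℝ) * q)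
    linarith

/-- The vectors `(0, 1), (1, 0), …` determined by the entries `c`. -/
def hjSeq (c : ℕ → ℕ) : ℕ → ℤ × ℤ
  | 0 => (0, 1)
  | 1 => (1, 0)
  | k + 2 => c k • hjSeq c (k + 1) - hjSeq c k

theorem hjSeq_add (c : ℕ → ℕ) (k : ℕ) :
    hjSeq c (k + 2) + hjSeq c k = c k • hjSeq c (k + 1) := by
  simp [hjSeq]

theorem hjSeq_fst (c : ℕ → ℕ) (k : ℕ) :
    (hjSeq c (k + 2)).1 = c k * (hjSeq c (k + 1)).1 - (hjSeq c k).1 := by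
  simp [hjSeq]

theorem hjSeq_snd (c : ℕ → ℕ) (k : ℕ) :
    (hjSeq c (k + 2)).2 = c k * (hjSeq c (k + 1)).2 - (hjSeq c k).2 := by
  simp [hjSeq]

theorem hjSeq_det (c : ℕ → ℕ) (k : ℕ) :
    (hjSeq c k).2 * (hjSeq c (k + 1)).1 - (hjSeq c k).1 * (hjSeq c (k + 1)).2 = 1 := by
  induction k with
  | zero => simp [hjSeq]
  | succ k ih => rw [hjSeq_fst, hjSeq_snd]; linear_combination ih

theorem hjSeq_fst_lt {c : ℕ → ℕ} (hc : ∀ k, 2 ≤ c k) (k : ℕ) :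
    0 ≤ (hjSeq c k).1 ∧ (hjSeq c k).1 < (hjSeq c (k + 1)).1 := by
  induction k with
  | zero => simp [hjSeq]
  | succ k ih =>
    rw [hjSeq_fst]
    have : (2 : ℤ) ≤ c k := by exact_mod_cast hc k
    constructor
    · linarith
    · nlinarith

theorem hjSeq_strictMono {c : ℕ → ℕ} (hc : ∀ k, 2 ≤ c k) :
    StrictMono fun k => (hjSeq c k).1 :=
  strictMono_nat_of_lt_succ fun k => (hjSeq_fst_lt hc k).2

/-- Numerator and denominator of a Hirzebruch-Jung continued fraction. -/
def hjPair : List ℕ → ℤ × ℤ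
  | [] => (1, 0)
  | a :: L => (a * (hjPair L).1 - (hjPair L).2, (hjPair L).1)

theorem hjPair_lt : ∀ {L : List ℕ}, (∀ a ∈ L, 2 ≤ a) →
    0 ≤ (hjPair L).2 ∧ (hjPair L).2 < (hjPair L).1
  | [], _ => by simp [hjPair]
  | a :: L, h => by
    have ih := hjPair_lt (L := L) fun b hb => h b (by simp [hb])
    have : (2 : ℤ) ≤ a := by exact_mod_cast h a (by simp)
    simp only [hjPair]
    constructor
    · linarith
    · nlinarith

theorem hjPair_isCoprime : ∀ L : List ℕ, IsCoprime (hjPair L).1 (hjPair L).2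
  | [] => by simp [hjPair, isCoprime_zero_right]
  | a :: L => by
    obtain ⟨x, y, h⟩ := hjPair_isCoprime L
    exact ⟨-y, x + a * y, by simp only [hjPair]; linear_combination h⟩

theorem hjValue_eq : ∀ {L : List ℕ}, L ≠ [] → (∀ a ∈ L, 2 ≤ a) →
    hjValue L = ((hjPair L).1 : ℚ) / (hjPair L).2
  | [], h, _ => (h rfl).elim
  | [a], _, _ => by simp [hjValue, hjPair]
  | a :: b :: L, _, h => by
    have h' : ∀ x ∈ b :: L, 2 ≤ x := fun x hx => h x (by simp at hx ⊢; tauto)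
    have ih := hjValue_eq (L := b :: L) (by simp) h'
    have h2 := hjPair_lt h'
    have h3 : ((hjPair (b :: L)).1 : ℚ) ≠ 0 := by
      have : (hjPair (b :: L)).1 ≠ 0 := by omega
      exact_mod_cast this
    rw [hjValue, ih]
    conv_rhs => rw [hjPair]
    push_cast
    field_simp

/-- Stated for an arbitrary sequence because removing the first entry shifts the starting pair to
w₁, w₂. -/
theorem recurrence_last : ∀ (L : List ℕ) (w : ℕ → ℤ × ℤ),
    (∀ k (h : k < L.length), w (k + 2) + w k = L[k] • w (k + 1)) →
    w (L.length + 1) = (hjPair L).1 • w 1 - (hjPair L).2 • w 0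
  | [], w, _ => by simp [hjPair]
  | a :: L, w, h => by
    have ih := recurrence_last L (fun k => w (k + 1)) fun k hk =>
      h (k + 1) (by simpa using hk)
    have h0 := h 0 (by simp)
    simp only [zero_add, List.getElem_cons_zero] at h0
    have h0' : w 2 = (a : ℤ) • w 1 - w 0 := by
      rw [natCast_zsmul, ← h0]; abel
    simp only [List.length_cons, hjPair]
    simp only [zero_add] at ih
    rw [ih, show 1 + 1 = 2 from rfl, h0']
    module

/-- Both `hjPair` and (q, p) are in lowest terms with positive numerator and represent the same
fraction, so they coincide. -/
theorem hjSeq_last {n p q : ℕ} {c : Fin n → ℕ} (hn : 0 < n) (hp : 0 < p) (hq : 0 < q)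
    (hcop : Nat.Coprime p q) (hc : IsHirzebruchJung p q c) {c' : ℕ → ℕ}
    (hc' : ∀ k : Fin n, c' k = c k) : hjSeq c' (n + 1) = ((q : ℤ), -(p : ℤ)) := by
  have hmem : ∀ a ∈ List.ofFn c, 2 ≤ a := by
    intro a ha
    obtain ⟨k, rfl⟩ := (List.mem_ofFn' _ _).1 ha
    exact hc.two_le k
  have h1 := recurrence_last (List.ofFn c) (hjSeq c') fun k hk => by
    rw [hjSeq_add, List.getElem_ofFn, ← hc']
  rw [List.length_ofFn] at h1
  have hv := hc.value
  rw [hjValue_eq (by simp; omega) hmem] at hv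
  have hlt := hjPair_lt hmem
  have hco := hjPair_isCoprime (List.ofFn c)
  generalize hjPair (List.ofFn c) = r at *
  obtain ⟨Q, P⟩ := r
  simp only at *
  have hp' : (p : ℚ) ≠ 0 := by exact_mod_cast hp.ne'
  have hq' : (q : ℚ) ≠ 0 := by exact_mod_cast hq.ne'
  have hP : (P : ℚ) ≠ 0 := by
    intro h
    rw [h, div_zero] at hv
    exact div_ne_zero hq' hp' hv.symm
  have hcross : Q * p = q * P := by
    rw [div_eq_div_iff hP hp'] at hv
    exact_mod_cast hv
  have hcop' : IsCoprime (q : ℤ) p := (Nat.isCoprime_iff_coprime.2 hcop).symm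
  have hQ : Q = q := by
    apply Int.dvd_antisymm (by omega) (by omega)
    · exact hco.dvd_of_dvd_mul_right ⟨p, hcross.symm⟩
    · exact hcop'.dvd_of_dvd_mul_right ⟨P, hcross⟩
  subst hQ
  have hPp : P = p := by
    have : (q : ℤ) * p = q * P := hcross
    exact (mul_left_cancel₀ (by omega) this).symm
  rw [h1, hPp]
  simp [hjSeq]

theorem hjSeq_mem {n p q : ℕ} {c : ℕ → ℕ} (hc : ∀ k, 2 ≤ c k)
    (h : hjSeq c (n + 1) = ((q : ℤ), -(p : ℤ))) {k : ℕ} (hk : k ≤ n + 1) :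
    hjSeq c k ∈ dualSemigroup p q := by
  refine mem_dualSemigroup.2 ⟨(hjSeq_fst_lt hc k).1, ?_⟩
  -- The pairing with (p, q) is 0 at index n + 1 and, by the determinant identity, 1 at index n.
  -- Descending induction with c ≥ 2 shows that it only grows towards index 0.
  have key : ∀ k ≤ n, 0 ≤ p * (hjSeq c (k + 1)).1 + q * (hjSeq c (k + 1)).2 ∧
      p * (hjSeq c (k + 1)).1 + q * (hjSeq c (k + 1)).2 ≤
        p * (hjSeq c k).1 + q * (hjSeq c k).2 := by
    intro k hk
    induction hk using Nat.decreasingInduction with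
    | self =>
      have := hjSeq_det c n
      rw [h] at this ⊢
      simp only at *
      constructor <;> linarith
    | of_succ k hk ih =>
      rw [hjSeq_fst, hjSeq_snd] at ih
      have : (2 : ℤ) ≤ c k := by exact_mod_cast hc k
      constructor
      · linarith
      · nlinarith
  rcases k with _ | k
  · simp [hjSeq]
  · exact (key k (by omega)).1

theorem exists_sign_change {f : ℕ → ℤ} : ∀ {n : ℕ}, 0 ≤ f 0 → f (n + 1) ≤ 0 →
    ∃ k ≤ n, 0 ≤ f k ∧ f (k + 1) ≤ 0
  | 0, h0, h1 => ⟨0, le_rfl, h0, h1⟩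
  | n + 1, h0, h1 => by
    by_cases h : f (n + 1) ≤ 0
    · obtain ⟨k, hk, h⟩ := exists_sign_change h0 h
      exact ⟨k, by omega, h⟩
    · exact ⟨n + 1, le_rfl, by omega, h1⟩

theorem closure_hjSeq {n p q : ℕ} {c : ℕ → ℕ} (hc : ∀ k, 2 ≤ c k)
    (h : hjSeq c (n + 1) = ((q : ℤ), -(p : ℤ))) :
    AddSubmonoid.closure (Set.range fun k : Fin (n + 2) => hjSeq c k) = dualSemigroup p q := by
  apply le_antisymm
  · rw [AddSubmonoid.closure_le]
    rintro _ ⟨k, rfl⟩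
    exact hjSeq_mem hc h (by omega)
  · intro w hw
    rw [mem_dualSemigroup] at hw
    -- The determinant of w against the successive vectors changes sign, so w lies in the cone of
    -- two neighbours. These form a lattice basis, and Cramer's rule gives natural coefficients.
    obtain ⟨k, hk, h1, h2⟩ := exists_sign_change
      (f := fun k => (hjSeq c k).2 * w.1 - (hjSeq c k).1 * w.2) (n := n)
      (by simpa [hjSeq] using hw.1) (by simp only [h]; linarith [hw.2])
    have hdet := hjSeq_det c k
    have hw' : w = (-((hjSeq c (k + 1)).2 * w.1 - (hjSeq c (k + 1)).1 * w.2)).toNat • hjSeq c k +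
        ((hjSeq c k).2 * w.1 - (hjSeq c k).1 * w.2).toNat • hjSeq c (k + 1) := by
      rw [← natCast_zsmul, ← natCast_zsmul, Int.toNat_of_nonneg (by linarith),
        Int.toNat_of_nonneg h1]
      ext
      · simp only [Prod.fst_add, Prod.smul_fst, smul_eq_mul]
        linear_combination (-w.1) * hdet
      · simp only [Prod.snd_add, Prod.smul_snd, smul_eq_mul]
        linear_combination (-w.2) * hdet
    rw [hw']
    refine add_mem (nsmul_mem (AddSubmonoid.subset_closure
        (Set.mem_range_self (⟨k, by omega⟩ : Fin (n + 2)))) _)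
      (nsmul_mem (AddSubmonoid.subset_closure
        (Set.mem_range_self (⟨k + 1, by omega⟩ : Fin (n + 2)))) _)

/-! ### Identification and irreducibility of the minimal generators -/

/-- Leastness puts the generators inside the explicit generating set. Both sets have n + 2 elements,
so they agree, and the order by first coordinate fixes the indexing. -/
theorem IsMinimalGenerators.eq_hjSeq {n p q : ℕ} {c : ℕ → ℕ} (hc : ∀ k, 2 ≤ c k)
    (h : hjSeq c (n + 1) = ((q : ℤ), -(p : ℤ))) {u : Fin (n + 2) → ℤ × ℤ}
    (hu : IsMinimalGenerators p q u) (k : Fin (n + 2)) : u k = hjSeq c k := by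
  have hv : StrictMono fun k : Fin (n + 2) => (hjSeq c k).1 := fun a b hab =>
    hjSeq_strictMono hc hab
  have hsub : Set.range u ⊆ Set.range fun k : Fin (n + 2) => hjSeq c k :=
    hu.isLeast.2 (closure_hjSeq hc h)
  have hinj : Function.Injective u := fun a b hab => hu.strictMono.injective (by simp [hab])
  have hinj' : Function.Injective fun k : Fin (n + 2) => hjSeq c k := fun a b hab =>
    hv.injective (by simp only at hab; simp [hab])
  have hrange : Set.range u = Set.range fun k : Fin (n + 2) => hjSeq c k := by
    apply Set.eq_of_subset_of_ncard_le hsub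
    rw [← Set.image_univ, ← Set.image_univ, Set.ncard_image_of_injective _ hinj,
      Set.ncard_image_of_injective _ hinj']
  have hfst : (fun k => (u k).1) = fun k : Fin (n + 2) => (hjSeq c k).1 := by
    apply (hu.strictMono.range_inj hv).1
    have := congrArg (Set.image Prod.fst) hrange
    rwa [← Set.range_comp, ← Set.range_comp] at this
  obtain ⟨j, hj⟩ := hsub ⟨k, rfl⟩
  have : j = k := hv.injective (by
    have := congrFun hfst k
    simp only at hj this ⊢
    rw [← this, ← hj])
  rw [← hj, this]

theorem IsMinimalGenerators.eq_zero_of_sum_eq_zero {e p q : ℕ} {u : Fin e → ℤ × ℤ}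
    (hq : 0 < q) (hu : IsMinimalGenerators p q u) (hne : ∀ k, u k ≠ 0) {α : Fin e →₀ ℕ}
    (h : ∑ k, α k • u k = 0) : α = 0 := by
  have hmem : ∀ k, u k ∈ dualSemigroup p q := fun k => by
    have := hu.isLeast.1
    simp only [Set.mem_ofPred_eq] at this
    rw [← this]
    exact AddSubmonoid.subset_closure ⟨k, rfl⟩
  have hpos : ∀ k, 0 < (u k).1 + (p * (u k).1 + q * (u k).2) := by
    intro k
    obtain ⟨h1, h2⟩ := mem_dualSemigroup.1 (hmem k)
    by_contra hcon
    have h3 : (u k).1 = 0 := by linarith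
    have h4 : (q : ℤ) * (u k).2 = 0 := by rw [h3] at hcon h2; linarith
    have h5 : (u k).2 = 0 := by
      rcases mul_eq_zero.1 h4 with h | h
      · omega
      · exact h
    exact hne k (Prod.ext h3 h5)
  have h1 := congrArg Prod.fst h
  have h2 := congrArg Prod.snd h
  simp only [Prod.fst_sum, Prod.snd_sum, Prod.smul_fst, Prod.smul_snd,
    Prod.fst_zero, Prod.snd_zero] at h1 h2
  simp only [nsmul_eq_mul] at h1 h2
  have hsum : ∑ k, (α k : ℤ) * ((u k).1 + (p * (u k).1 + q * (u k).2)) = 0 := by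
    have : ∑ k, (α k : ℤ) * ((u k).1 + (p * (u k).1 + q * (u k).2)) =
        ∑ k, (α k : ℤ) * (u k).1 + (p * ∑ k, (α k : ℤ) * (u k).1 +
          q * ∑ k, (α k : ℤ) * (u k).2) := by
      rw [Finset.mul_sum, Finset.mul_sum, ← Finset.sum_add_distrib, ← Finset.sum_add_distrib]
      exact Finset.sum_congr rfl fun k _ => by ring
    rw [this, h1, h2]
    simp
  rw [Finset.sum_eq_zero_iff_of_nonneg fun k _ => mul_nonneg (by positivity) (hpos k).le] at hsum
  ext k
  have := hsum k (Finset.mem_univ k)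
  rcases mul_eq_zero.1 this with h | h
  · simpa using h
  · exact absurd h (hpos k).ne'

theorem IsMinimalGenerators.eq_of_sum_eq {e p q : ℕ} {u : Fin e → ℤ × ℤ}
    (hq : 0 < q) (hu : IsMinimalGenerators p q u) (hne : ∀ k, u k ≠ 0) {α β : Fin e →₀ ℕ}
    (hα : α.degree ≤ 1) (h : ∑ k, α k • u k = ∑ k, β k • u k) : α = β := by
  rcases Nat.le_one_iff_eq_zero_or_eq_one.1 hα with h0 | h1
  · rw [Finsupp.degree_eq_zero_iff] at h0
    subst h0
    exact (hu.eq_zero_of_sum_eq_zero hq hne (by simpa using h.symm)).symm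
  · obtain ⟨j, rfl⟩ : ∃ j, α = Finsupp.single j 1 := by
      obtain ⟨j, hj⟩ : ∃ j, α j ≠ 0 := by
        by_contra! hcon
        have : α = 0 := Finsupp.ext hcon
        simp [this] at h1
      obtain ⟨γ, rfl⟩ := exists_add_of_le
        (show Finsupp.single j 1 ≤ α by rw [Finsupp.single_le_iff]; omega)
      have : γ = 0 := by
        rw [← Finsupp.degree_eq_zero_iff]
        simpa using h1
      exact ⟨j, by rw [this, add_zero]⟩
    have hj : ∑ k, (Finsupp.single j 1 : Fin e →₀ ℕ) k • u k = u j := by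
      simp [Finsupp.single_apply, ite_smul]
    rw [hj] at h
    by_cases hβ : β j = 0
    · exfalso
      -- A relation for u_j not involving u_j would make it redundant, against leastness.
      have hgen : AddSubmonoid.closure (Set.range u \ {u j}) = dualSemigroup p q := by
        have := hu.isLeast.1
        simp only [Set.mem_ofPred_eq] at this
        rw [← this]
        apply le_antisymm (AddSubmonoid.closure_mono Set.sdiff_subset)
        rw [AddSubmonoid.closure_le]
        rintro _ ⟨k, rfl⟩
        by_cases hk : u k = u j
        · suffices hs : ∑ k, β k • u k ∈ AddSubmonoid.closure (Set.range u \ {u j}) by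
            rw [← h] at hs
            exact hk ▸ hs
          refine sum_mem fun i _ => ?_
          by_cases hi : u i = u j
          · have : i = j := hu.strictMono.injective (by simp [hi])
            rw [this, hβ, zero_smul]
            exact zero_mem _
          · exact nsmul_mem (AddSubmonoid.subset_closure (show u i ∈ Set.range u \ {u j} from
              ⟨⟨i, rfl⟩, hi⟩)) _
        · exact AddSubmonoid.subset_closure ⟨⟨k, rfl⟩, hk⟩
      have := hu.isLeast.2 hgen ⟨j, rfl⟩
      exact this.2 rfl
    · have hle : Finsupp.single j 1 ≤ β := by
        rw [Finsupp.single_le_iff]; omega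
      obtain ⟨γ, rfl⟩ := exists_add_of_le hle
      have : γ = 0 := by
        apply hu.eq_zero_of_sum_eq_zero hq hne
        simp only [Finsupp.add_apply, add_smul, Finset.sum_add_distrib] at h
        rw [hj] at h
        simpa using h
      rw [this, add_zero]

/-! ### Convex recurrences -/

/-- Along a convex recurrence every term is `d w₀ + a (w₁ - w₀)` with `1 ≤ d` and `0 ≤ a`. -/
theorem exists_coords_of_recurrence {G : Type*} [AddCommGroup G] {w : ℕ → G} {c : ℕ → ℕ} {N : ℕ}
    (hc : ∀ k, 2 ≤ c k) (hw : ∀ k < N, w (k + 2) + w k = c k • w (k + 1)) {k : ℕ}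
    (hk : k ≤ N + 1) : ∃ d a : ℕ, 1 ≤ d ∧ w k = d • w 0 + a • (w 1 - w 0) := by
  have key : ∀ k ≤ N, (∃ d a : ℕ, 1 ≤ d ∧ w k = d • w 0 + a • (w 1 - w 0)) ∧
      ∃ d a : ℕ, w (k + 1) - w k = d • w 0 + a • (w 1 - w 0) := by
    intro k hk
    induction k with
    | zero => exact ⟨⟨1, 0, le_rfl, by simp⟩, 0, 1, by simp⟩
    | succ k ih =>
      obtain ⟨⟨d, a, hd, h1⟩, d', a', h2⟩ := ih (by omega)
      have h3 : w (k + 1) = (d + d') • w 0 + (a + a') • (w 1 - w 0) := by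
        rw [← sub_add_cancel (w (k + 1)) (w k), h2, h1, add_smul, add_smul]; abel
      refine ⟨⟨d + d', a + a', by omega, h3⟩,
        (c k - 2) * (d + d') + d', (c k - 2) * (a + a') + a', ?_⟩
      -- As c ≥ 2, each increment is the previous one plus a nonnegative multiple of a term, so
      -- terms and increments stay in the cone of w₀ and w₁ - w₀.
      have h4 : w (k + 2) - w (k + 1) = (c k - 2) • w (k + 1) + (w (k + 1) - w k) := by
        obtain ⟨b, hb⟩ := Nat.exists_eq_add_of_le (hc k)
        rw [eq_sub_of_add_eq (hw k (by omega)), hb, Nat.add_sub_cancel_left, add_smul, two_smul]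
        abel
      rw [h4, h2, h3, smul_add, smul_smul, smul_smul, add_smul _ d', add_smul _ a']
      abel
  rcases k with _ | k
  · exact (key 0 (by omega)).1
  · obtain ⟨⟨d, a, hd, h1⟩, d', a', h2⟩ := key k (by omega)
    refine ⟨d + d', a + a', by omega, ?_⟩
    rw [← sub_add_cancel (w (k + 1)) (w k), h2, h1, add_smul, add_smul]; abel

/-- Produces the relation that expresses x_j x_k as a monomial in the variables strictly between
them, from which the outer variables are solved. -/
theorem exists_add_eq_sum {G : Type*} [AddCommGroup G] {N : ℕ} {u : Fin N → G} {w : ℕ → G}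
    {c : ℕ → ℕ} (hu : ∀ k, u k = w k) (hc : ∀ k, 2 ≤ c k)
    (hw : ∀ k, w (k + 2) + w k = c k • w (k + 1)) {j k : Fin N}
    (hjk : (j : ℕ) + 2 ≤ k) :
    ∃ α : Fin N →₀ ℕ, (∀ r, α r ≠ 0 → j < r ∧ r < k) ∧ u j + u k = ∑ r, α r • u r := by
  -- Splitting off the last intermediate vector makes the induction on the gap work: the next
  -- recurrence replaces it by its successor and adds c - 2 further copies of that successor.
  have key : ∀ (h : ℕ) (hN : (j : ℕ) + 2 + h < N), ∃ α : Fin N →₀ ℕ,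
      (∀ r, α r ≠ 0 → (j : ℕ) < r ∧ (r : ℕ) < j + 2 + h) ∧
      w j + w (j + 2 + h) = w (j + 1 + h) + ∑ r, α r • u r := by
    intro h
    induction h with
    | zero =>
      intro hN
      refine ⟨Finsupp.single ⟨j + 1, by omega⟩ (c j - 1), ?_, ?_⟩
      · intro r hr
        have : r = ⟨j + 1, by omega⟩ := by
          by_contra hcon
          exact hr (by rw [Finsupp.single_apply, if_neg (Ne.symm hcon)])
        subst this
        simp
      · have := hw j
        simp only [Finsupp.single_apply, ite_smul, zero_smul, Finset.sum_ite_eq, Finset.mem_univ,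
          if_true, hu, add_zero]
        obtain ⟨b, hb⟩ := Nat.exists_eq_add_of_le (hc j)
        rw [add_comm (w j), this, hb, show 2 + b - 1 = 1 + b by omega,
          show 2 + b = 1 + (1 + b) by omega,
          add_smul 1 (1 + b), one_smul]
    | succ h ih =>
      intro hN
      obtain ⟨α, hα, hsum⟩ := ih (by omega)
      refine ⟨α + Finsupp.single ⟨j + 2 + h, by omega⟩ (c (j + 1 + h) - 2), ?_, ?_⟩
      · intro r hr
        by_cases hr' : r = ⟨j + 2 + h, by omega⟩
        · subst hr'
          simp only
          omega
        · have := hα r (by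
            simpa [Finsupp.single_apply, Ne.symm hr'] using hr)
          omega
      · have h1 := hw (j + 1 + h)
        simp only [Finsupp.add_apply, add_smul, Finset.sum_add_distrib]
        simp only [Finsupp.single_apply, ite_smul, zero_smul, Finset.sum_ite_eq, Finset.mem_univ,
          if_true, hu]
        simp only [hu] at hsum
        obtain ⟨b, hb⟩ := Nat.exists_eq_add_of_le (hc (j + 1 + h))
        rw [hb, add_smul, two_smul] at h1
        rw [hb, Nat.add_sub_cancel_left]
        rw [show (j : ℕ) + 1 + h + 2 = j + 2 + (h + 1) by omega,
          show (j : ℕ) + 1 + h + 1 = j + 2 + h by omega] at h1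
        rw [show (j : ℕ) + 1 + (h + 1) = j + 2 + h by omega]
        rw [eq_sub_of_add_eq h1, eq_sub_of_add_eq' hsum.symm]
        abel
  obtain ⟨h, hh⟩ := Nat.exists_eq_add_of_le hjk
  have hlt := k.2
  obtain ⟨α, hα, hsum⟩ := key h (by omega)
  refine ⟨α + Finsupp.single ⟨j + 1 + h, by omega⟩ 1, ?_, ?_⟩
  · intro r hr
    by_cases hr' : r = ⟨j + 1 + h, by omega⟩
    · subst hr'
      rw [Fin.lt_def, Fin.lt_def]
      simp only
      omega
    · have := hα r (by
        simpa [Finsupp.single_apply, Ne.symm hr'] using hr)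
      rw [Fin.lt_def, Fin.lt_def]
      omega
  · simp only [Finsupp.add_apply, add_smul, Finset.sum_add_distrib]
    simp only [Finsupp.single_apply, ite_smul, zero_smul, Finset.sum_ite_eq, Finset.mem_univ,
      if_true, one_smul, hu]
    simp only [hu] at hsum
    rw [hh, hsum, add_comm]

/-! ### The toric ideal and its binomials -/

section Toric

variable {K : Type*} [Field K] {e : ℕ} {u : Fin e → ℤ × ℤ}

theorem aeval_single_monomial (α : Fin e →₀ ℕ) (k : K) :
    (MvPolynomial.aeval (fun j => AddMonoidAlgebra.single (u j) (1 : K)) :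
      MvPolynomial (Fin e) K →ₐ[K] AddMonoidAlgebra K (ℤ × ℤ)) (MvPolynomial.monomial α k) =
      AddMonoidAlgebra.single (∑ j, α j • u j) k := by
  have h : ∀ s : Finset (Fin e), ∏ j ∈ s, (AddMonoidAlgebra.single (u j) (1 : K)) ^ α j =
      AddMonoidAlgebra.single (∑ j ∈ s, α j • u j) 1 := by
    intro s
    induction s using Finset.induction_on with
    | empty => simp [AddMonoidAlgebra.one_def]
    | insert a s ha ih =>
      rw [Finset.prod_insert ha, Finset.sum_insert ha, ih, AddMonoidAlgebra.single_pow,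
        AddMonoidAlgebra.single_mul_single, one_pow, one_mul]
  rw [MvPolynomial.aeval_monomial, Finsupp.prod_fintype _ _ (by simp), h,
    ← Algebra.smul_def, AddMonoidAlgebra.smul_single, smul_eq_mul, mul_one]

theorem monomial_sub_monomial_mem {α β : Fin e →₀ ℕ}
    (h : ∑ j, α j • u j = ∑ j, β j • u j) :
    (MvPolynomial.monomial α 1 - MvPolynomial.monomial β 1 : MvPolynomial (Fin e) K) ∈
      toricIdeal K u := by
  rw [toricIdeal, RingHom.mem_ker, map_sub, aeval_single_monomial, aeval_single_monomial, h,
    sub_self]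

/-- The binomial conditions make the monomials in x well defined modulo 𝔫 as a function of the
exponent in M. Extending this function linearly to K[M] factors evaluation modulo 𝔫 through the map
defining the toric ideal. -/
theorem aeval_mem_of_mem_toricIdeal {A : Type*} [CommRing A] [Algebra K A] {𝔫 : Ideal A}
    {x : Fin e → A}
    (hx : ∀ α β : Fin e →₀ ℕ, ∑ j, α j • u j = ∑ j, β j • u j →
      ∏ j, x j ^ α j - ∏ j, x j ^ β j ∈ 𝔫)
    {f : MvPolynomial (Fin e) K} (hf : f ∈ toricIdeal K u) : MvPolynomial.aeval x f ∈ 𝔫 := by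
  classical
  have hΨ : ∃ Ψ : ℤ × ℤ → A ⧸ 𝔫, ∀ α : Fin e →₀ ℕ,
      Ψ (∑ j, α j • u j) = Ideal.Quotient.mk 𝔫 (∏ j, x j ^ α j) := by
    -- Outside the semigroup generated by u the value is irrelevant, as only linearity of the
    -- extension is used.
    refine ⟨fun w => if h : ∃ α : Fin e →₀ ℕ, ∑ j, α j • u j = w then
      Ideal.Quotient.mk 𝔫 (∏ j, x j ^ h.choose j) else 0, fun α => ?_⟩
    have h : ∃ β : Fin e →₀ ℕ, ∑ j, β j • u j = ∑ j, α j • u j := ⟨α, rfl⟩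
    simp only [dif_pos h]
    exact Ideal.Quotient.eq.2 (hx _ _ h.choose_spec)
  obtain ⟨Ψ, hΨ⟩ := hΨ
  let Λ : AddMonoidAlgebra K (ℤ × ℤ) →ₗ[K] A ⧸ 𝔫 :=
    (Finsupp.linearCombination K Ψ).comp (AddMonoidAlgebra.coeffLinearEquiv K).toLinearMap
  have key : ∀ g : MvPolynomial (Fin e) K,
      Λ (MvPolynomial.aeval (fun j => AddMonoidAlgebra.single (u j) (1 : K)) g) =
        Ideal.Quotient.mk 𝔫 (MvPolynomial.aeval x g) := by
    intro g
    induction g using MvPolynomial.induction_on' with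
    | monomial α k =>
      rw [aeval_single_monomial, MvPolynomial.aeval_monomial, Finsupp.prod_fintype _ _ (by simp)]
      have hΛ : ∀ w, Λ (AddMonoidAlgebra.single w k) = k • Ψ w := fun w => by simp [Λ]
      rw [hΛ, hΨ, Algebra.smul_def, map_mul]
      rfl
    | add p q hp hq => rw [map_add, map_add, map_add, map_add, hp, hq]
  rw [← Ideal.Quotient.eq_zero_iff_mem, ← key, (RingHom.mem_ker).1 hf, map_zero]

theorem dvd_monomial_sub_monomial {A : Type*} [CommRing A] [Algebra K A] {t : A}
    {x : Fin e → A} (hx : ∀ f ∈ toricIdeal K u, t ∣ MvPolynomial.aeval x f) {α β : Fin e →₀ ℕ}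
    (h : ∑ j, α j • u j = ∑ j, β j • u j) : t ∣ ∏ j, x j ^ α j - ∏ j, x j ^ β j := by
  have := hx _ (monomial_sub_monomial_mem h)
  rwa [map_sub, MvPolynomial.aeval_monomial, MvPolynomial.aeval_monomial,
    Finsupp.prod_fintype _ _ (by simp), Finsupp.prod_fintype _ _ (by simp), map_one, one_mul,
    one_mul] at this

end Toric

/-! ### Order of vanishing of the binomials -/

/-- The exponents differ by a multiple of (k, -1, -1), so substituting T^k = xy suffices and nothing
has to be cancelled. -/
theorem pow_mul_pow_mul_pow_eq {B : Type*} [CommRing B] {T x y : B} {k : ℕ} (h : T ^ k = x * y)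
    {D D' a a' b b' : ℕ} (hab : a + b' = a' + b) (hD : D + k * b = D' + k * b') :
    T ^ D * x ^ a * y ^ b = T ^ D' * x ^ a' * y ^ b' := by
  wlog hb : b ≤ b' generalizing D D' a a' b b'
  · exact (this hab.symm hD.symm (by omega)).symm
  obtain ⟨r, rfl⟩ := Nat.exists_eq_add_of_le hb
  obtain rfl : a' = a + r := by omega
  obtain rfl : D = D' + k * r := by rw [mul_add] at hD; omega
  rw [pow_add, pow_mul, h, mul_pow, pow_add x, pow_add y]
  ring

theorem prod_eq_sq_mul {A B : Type*} [CommRing A] [CommRing B] (φ : A →+* B) {e : ℕ} {T : A}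
    {z : Fin e → A} {x y : B} {d a b : Fin e → ℕ} (hd : ∀ j, 1 ≤ d j)
    (hz : ∀ j, φ (z j) = φ T ^ (d j - 1) * x ^ a j * y ^ b j) {α : Fin e →₀ ℕ}
    (hα : 2 ≤ α.degree) : ∃ w, ∏ j, (T * z j) ^ α j = T ^ 2 * w ∧
      φ w = φ T ^ (∑ j, α j * d j - 2) * x ^ (∑ j, α j * a j) * y ^ (∑ j, α j * b j) := by
  have hdeg : α.degree = ∑ j, α j := Finsupp.degree_eq_sum α
  refine ⟨T ^ (α.degree - 2) * ∏ j, z j ^ α j, ?_, ?_⟩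
  · rw [← mul_assoc, ← pow_add, Nat.add_sub_of_le hα, hdeg, ← Finset.prod_pow_eq_pow_sum,
      ← Finset.prod_mul_distrib]
    simp only [mul_pow]
  · have h1 : ∑ j, α j * d j = ∑ j, (d j - 1) * α j + α.degree := by
      rw [hdeg, ← Finset.sum_add_distrib]
      refine Finset.sum_congr rfl fun j _ => ?_
      obtain ⟨r, hr⟩ := Nat.exists_eq_add_of_le (hd j)
      rw [hr, Nat.add_sub_cancel_left]; ring
    rw [h1, Nat.add_sub_assoc hα, pow_add, map_mul, map_pow, map_prod,
      ← Finset.prod_pow_eq_pow_sum, ← Finset.prod_pow_eq_pow_sum, ← Finset.prod_pow_eq_pow_sum]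
    simp only [map_pow, hz, mul_pow, ← pow_mul, Finset.prod_mul_distrib]
    simp only [mul_comm (a _), mul_comm (b _)]
    ring

/-- The binomials of degree at least two in the toric ideal vanish to the expected order. -/
theorem dvd_prod_sub_prod {A : Type*} [CommRing A] {e : ℕ} {T t : A} {z : Fin e → A}
    {x y : A} {d a b : Fin e → ℕ} {k : ℕ} (hd : ∀ j, 1 ≤ d j) (hxy : t ∣ T ^ k - x * y)
    (hz : ∀ j, t ∣ z j - T ^ (d j - 1) * x ^ a j * y ^ b j) {P Q : ℤ × ℤ}
    (hPQ : P.1 * Q.2 - P.2 * Q.1 ≠ 0)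
    {u : Fin e → ℤ × ℤ} (hu : ∀ j, u j = d j • P + a j • (Q - P) + b j • (k • P - (Q - P)))
    {α β : Fin e →₀ ℕ} (hα : 2 ≤ α.degree) (hβ : 2 ≤ β.degree)
    (h : ∑ j, α j • u j = ∑ j, β j • u j) :
    T ^ 2 * t ∣ ∏ j, (T * z j) ^ α j - ∏ j, (T * z j) ^ β j := by
  let φ := Ideal.Quotient.mk (Ideal.span {t})
  have hφ : ∀ {f g : A}, t ∣ f - g ↔ φ f = φ g := fun {f g} => by
    rw [Ideal.Quotient.eq, Ideal.mem_span_singleton]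
  have hz' : ∀ j, φ (z j) = φ T ^ (d j - 1) * φ x ^ a j * φ y ^ b j := fun j => by
    rw [hφ.1 (hz j)]; simp
  have hxy' : φ T ^ k = φ x * φ y := by rw [← map_pow, hφ.1 hxy, map_mul]
  obtain ⟨w, hw, hw'⟩ := prod_eq_sq_mul φ hd hz' hα
  obtain ⟨v, hv, hv'⟩ := prod_eq_sq_mul φ hd hz' hβ
  have hsum : ∀ γ : Fin e →₀ ℕ, ∑ j, γ j • u j =
      ((∑ j, γ j * d j : ℕ) + k * (∑ j, γ j * b j : ℕ) : ℤ) • P +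
        ((∑ j, γ j * a j : ℕ) - (∑ j, γ j * b j : ℕ) : ℤ) • (Q - P) := by
    intro γ
    simp only [hu, smul_add, smul_smul, Finset.sum_add_distrib, ← Finset.sum_smul]
    simp only [← natCast_zsmul]
    module
  rw [hsum, hsum] at h
  -- The nonzero determinant makes P and Q - P independent, so a relation among the u_j becomes two
  -- relations among exponents.
  have hlin : ∀ {a₁ a₂ b₁ b₂ : ℤ}, a₁ • P + b₁ • (Q - P) = a₂ • P + b₂ • (Q - P) →
      a₁ = a₂ ∧ b₁ = b₂ := by
    intro a₁ a₂ b₁ b₂ h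
    have h1 := congrArg Prod.fst h
    have h2 := congrArg Prod.snd h
    simp only [Prod.fst_add, Prod.snd_add, Prod.smul_fst, Prod.smul_snd, Prod.fst_sub,
      Prod.snd_sub, smul_eq_mul] at h1 h2
    have hb : (b₁ - b₂) * (P.1 * Q.2 - P.2 * Q.1) = 0 := by
      linear_combination P.1 * h2 - P.2 * h1
    have ha : (a₁ - b₁ - (a₂ - b₂)) * (P.1 * Q.2 - P.2 * Q.1) = 0 := by
      linear_combination Q.2 * h1 - Q.1 * h2
    have hb' := (mul_eq_zero.1 hb).resolve_right hPQ
    have ha' := (mul_eq_zero.1 ha).resolve_right hPQ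
    constructor <;> omega
  obtain ⟨h1, h2⟩ := hlin h
  -- Together with degree at least two, this makes the truncated exponent Σ γ_j d_j - 2 a genuine
  -- difference.
  have hge : ∀ γ : Fin e →₀ ℕ, γ.degree ≤ ∑ j, γ j * d j := fun γ => by
    rw [Finsupp.degree_eq_sum]
    exact Finset.sum_le_sum fun j _ => Nat.le_mul_of_pos_right _ (hd j)
  have hgα := hge α
  have hgβ := hge β
  rw [hw, hv, ← mul_sub]
  refine mul_dvd_mul_left _ (hφ.2 ?_)
  rw [hw', hv']
  apply pow_mul_pow_mul_pow_eq hxy'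
  · omega
  · have : (∑ j, α j * d j) + k * (∑ j, α j * b j) = (∑ j, β j * d j) + k * (∑ j, β j * b j) := by
      exact_mod_cast h1
    omega

/-! ### Points of the jet space as truncated power series -/

section Jets

variable {K : Type*} [Field K] {e m : ℕ} {R : Type*} [CommRing R] [Algebra K R]

/-- The `m`-jet with coefficients in `R` that corresponds to an `R`-point of the jet space. -/
noncomputable def evalJet (ev : JetRing K e m →ₐ[K] R) (j : Fin e) : PowerSeries R :=
  PowerSeries.mk fun b => if h : b < m + 1 then ev (MvPolynomial.X (j, ⟨b, h⟩)) else 0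

theorem coeff_aeval_evalJet (ev : JetRing K e m →ₐ[K] R) (f : MvPolynomial (Fin e) K) (b : ℕ) :
    PowerSeries.coeff b (MvPolynomial.aeval (evalJet ev) f) = ev (jetCoeff m f b) := by
  have key : (MvPolynomial.aeval (evalJet ev) : MvPolynomial (Fin e) K →ₐ[K] _).toRingHom =
      ((Polynomial.coeToPowerSeries.ringHom).comp (Polynomial.mapRingHom (ev : _ →+* R))).comp
        (universalJet K e m).toRingHom := by
    apply MvPolynomial.ringHom_ext
    · intro k
      simp [universalJet, MvPolynomial.algebraMap_eq, PowerSeries.algebraMap_apply]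
    · intro j
      ext b
      simp [universalJet, evalJet, Polynomial.coeff_monomial]
      split_ifs with h
      · rw [Finset.sum_eq_single ⟨b, by omega⟩]
        · simp
        · intro c _ hc
          rw [if_neg (fun h' => hc (Fin.ext h')), map_zero]
        · simp
      · rw [Finset.sum_eq_zero]
        intro c _
        rw [if_neg (by omega), map_zero]
  have h := congrArg (PowerSeries.coeff b) (DFunLike.congr_fun key f)
  simpa [jetCoeff] using h

theorem jetCoeff_X (j : Fin e) (b : Fin (m + 1)) :
    jetCoeff m (MvPolynomial.X j : MvPolynomial (Fin e) K) b = MvPolynomial.X (j, b) := by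
  simp [jetCoeff, universalJet, Polynomial.coeff_monomial, Fin.val_inj]

theorem jetIdeal_le_ker_iff (ev : JetRing K e m →ₐ[K] R) (I : Ideal (MvPolynomial (Fin e) K)) :
    (∀ g ∈ jetIdeal m I, ev g = 0) ↔
      ∀ f ∈ I, PowerSeries.X ^ (m + 1) ∣ MvPolynomial.aeval (evalJet ev) f := by
  simp only [PowerSeries.X_pow_dvd_iff, coeff_aeval_evalJet]
  constructor
  · intro h f hf b hb
    exact h _ (Ideal.subset_span ⟨f, hf, b, by omega, rfl⟩)
  · intro h g hg
    change g ∈ RingHom.ker ev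
    revert g
    change jetIdeal m I ≤ RingHom.ker ev
    rw [jetIdeal, Ideal.span_le]
    rintro _ ⟨f, hf, b, hb, rfl⟩
    exact h f hf b (by omega)

end Jets

/-! ### Division and prescribed coefficients of power series -/

section PowerSeries

variable {R : Type*} [CommRing R]

theorem X_pow_dvd_of_mul {s k : ℕ} {U f : PowerSeries R} (hU : IsUnit U)
    (h : PowerSeries.X ^ (s + k) ∣ PowerSeries.X ^ s * U * f) : PowerSeries.X ^ k ∣ f := by
  have h' : PowerSeries.X ^ (s + k) ∣ PowerSeries.X ^ s * f := by
    obtain ⟨U, rfl⟩ := hU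
    have := h.mul_left (↑U⁻¹ : PowerSeries R)
    rwa [mul_assoc, mul_left_comm, mul_left_comm (↑U⁻¹ : PowerSeries R), Units.mul_inv_cancel_left]
      at this
  rw [PowerSeries.X_pow_dvd_iff] at h' ⊢
  intro b hb
  have := h' (b + s) (by omega)
  rwa [PowerSeries.coeff_X_pow_mul] at this

/-- The power series with the coefficients of `f` in degrees below `k`, those of `g` in the degrees
from `k` to `m`, and zero in higher degrees. -/
noncomputable def glue (m k : ℕ) (f : PowerSeries R) (g : ℕ → R) : PowerSeries R :=
  PowerSeries.mk fun b => if b < k then PowerSeries.coeff b f else if b ≤ m then g b else 0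

theorem coeff_glue {m k b : ℕ} {f : PowerSeries R} {g : ℕ → R} (h : k ≤ b) (hb : b ≤ m) :
    PowerSeries.coeff b (glue m k f g) = g b := by
  simp [glue, hb, not_lt.2 h]

theorem coeff_glue_of_lt {m k b : ℕ} {f : PowerSeries R} {g : ℕ → R} (hk : k ≤ m + 1)
    (hb : m < b) : PowerSeries.coeff b (glue m k f g) = 0 := by
  simp only [glue, PowerSeries.coeff_mk]
  rw [if_neg (by omega), if_neg (by omega)]

theorem X_pow_dvd_glue_sub (m k : ℕ) (f : PowerSeries R) (g : ℕ → R) :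
    PowerSeries.X ^ k ∣ glue m k f g - f := by
  rw [PowerSeries.X_pow_dvd_iff]
  intro b hb
  simp [glue, hb]

theorem X_pow_dvd_glue {m k s : ℕ} {f : PowerSeries R} (g : ℕ → R) (hs : s ≤ k)
    (hf : PowerSeries.X ^ s ∣ f) : PowerSeries.X ^ s ∣ glue m k f g := by
  have := ((pow_dvd_pow _ hs).trans (X_pow_dvd_glue_sub m k f g)).add hf
  rwa [sub_add_cancel] at this

theorem exists_eq_X_pow_mul_unit {f : PowerSeries R} {s : ℕ} (hf : PowerSeries.X ^ s ∣ f)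
    (hs : IsUnit (PowerSeries.coeff s f)) :
    ∃ U : (PowerSeries R)ˣ, f = PowerSeries.X ^ s * (U : PowerSeries R) := by
  obtain ⟨U, rfl⟩ := hf
  have hU : IsUnit U := by
    rw [PowerSeries.isUnit_iff_constantCoeff]
    have := PowerSeries.coeff_X_pow_mul U s 0
    rw [zero_add] at this
    rwa [this, PowerSeries.coeff_zero_eq_constantCoeff_apply] at hs
  obtain ⟨U, rfl⟩ := hU
  exact ⟨U, rfl⟩

/-- Cancelling a factor of order s costs s orders of precision: the congruence modulo X^N fixes only
the coefficients below N - s. -/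
theorem eq_of_X_pow_dvd {N s : ℕ} (hs : s ≤ N) {U : (PowerSeries R)ˣ} {f g h : PowerSeries R}
    (hf : PowerSeries.X ^ N ∣ PowerSeries.X ^ s * (U : PowerSeries R) * f - h)
    (hg : PowerSeries.X ^ N ∣ PowerSeries.X ^ s * (U : PowerSeries R) * g - h)
    (hfg : ∀ b, N - s ≤ b → PowerSeries.coeff b f = PowerSeries.coeff b g) : f = g := by
  have h1 := hf.sub hg
  rw [sub_sub_sub_cancel_right, ← mul_sub] at h1
  obtain ⟨k, rfl⟩ := Nat.exists_eq_add_of_le hs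
  have h2 := X_pow_dvd_of_mul U.isUnit h1
  rw [PowerSeries.X_pow_dvd_iff] at h2
  ext b
  by_cases hb : b < k
  · exact sub_eq_zero.1 (by simpa using h2 b hb)
  · exact hfg b (by omega)

end PowerSeries

/-! ### Free coefficients and their number -/

/-- The coefficients of `x_j` of degree at least `freeFrom i m s l j` are free parameters on `D`. -/
def freeFrom {n : ℕ} (i : Fin n) (m s l : ℕ) (j : Fin (n + 2)) : ℕ :=
  if j = i.castSucc.succ then s else if j = i.succ.succ then l
  else if j = i.castSucc.castSucc then m + 1 - l else m + 1 - s

section FreeFrom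

variable {n : ℕ} (i : Fin n) (m s l : ℕ)

theorem freeFrom_mid : freeFrom i m s l i.castSucc.succ = s := by simp [freeFrom]

theorem freeFrom_right : freeFrom i m s l i.succ.succ = l := by
  simp [freeFrom, Fin.ext_iff]

theorem freeFrom_left : freeFrom i m s l i.castSucc.castSucc = m + 1 - l := by
  simp [freeFrom, Fin.ext_iff]
  omega

theorem freeFrom_of_ne {j : Fin (n + 2)} (h1 : j ≠ i.castSucc.succ) (h2 : j ≠ i.succ.succ)
    (h3 : j ≠ i.castSucc.castSucc) : freeFrom i m s l j = m + 1 - s := by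
  simp [freeFrom, h1, h2, h3]

theorem sum_freeFrom (hsl : s + l ≤ m + 1) (hs : 1 ≤ s) (h2s : 2 * s ≤ m + 1) :
    ∑ j, freeFrom i m s l j = s * (n + 2) + (m - (2 * s - 1)) * (n + 2 - 2) := by
  have h : ∀ j : Fin (n + 2), (freeFrom i m s l j : ℤ) = (m + 1 - s) +
      ((if j = i.castSucc.succ then (2 * s - m - 1 : ℤ) else 0) +
      ((if j = i.succ.succ then (l + s - m - 1 : ℤ) else 0) +
      (if j = i.castSucc.castSucc then (s - l : ℤ) else 0))) := by
    intro j
    by_cases h1 : j = i.castSucc.succ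
    · subst h1
      rw [freeFrom_mid, if_pos rfl, if_neg (by simp [Fin.ext_iff]), if_neg (by simp [Fin.ext_iff])]
      ring
    by_cases h2 : j = i.succ.succ
    · subst h2
      rw [freeFrom_right, if_neg h1, if_pos rfl, if_neg (by simp [Fin.ext_iff]; omega)]
      ring
    by_cases h3 : j = i.castSucc.castSucc
    · subst h3
      rw [freeFrom_left, if_neg h1, if_neg h2, if_pos rfl]
      push_cast [show l ≤ m + 1 by omega]
      ring
    · rw [freeFrom_of_ne i m s l h1 h2 h3, if_neg h1, if_neg h2, if_neg h3]
      push_cast [show s ≤ m + 1 by omega]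
      ring
  zify
  simp only [h, Finset.sum_add_distrib, Finset.sum_ite_eq', Finset.mem_univ, if_true,
    Finset.sum_const, Finset.card_univ, Fintype.card_fin]
  obtain ⟨r, hr⟩ := Nat.exists_eq_add_of_le h2s
  have h1 : m - (2 * s - 1) = r := by omega
  rw [h1, Nat.add_sub_cancel]
  have h2 : (m : ℤ) = 2 * s + r - 1 := by
    have : ((m + 1 : ℕ) : ℤ) = 2 * s + r := by exact_mod_cast hr
    push_cast at this
    linarith
  rw [h2]
  simp only [nsmul_eq_mul]
  push_cast
  ring

end FreeFrom

/-! ### Uniqueness of the jet with given free coefficients -/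

section Unique

variable {K : Type*} [Field K] {n : ℕ} {c : ℕ → ℕ} {u : Fin (n + 2) → ℤ × ℤ}
  {R : Type*} [CommRing R] [Algebra K R]

theorem prod_pow_single {A : Type*} [CommRing A] {e : ℕ} (x : Fin e → A) (j : Fin e) (k : ℕ) :
    ∏ r, x r ^ (Finsupp.single j k : Fin e →₀ ℕ) r = x j ^ k := by
  rw [← Finsupp.prod_fintype (Finsupp.single j k) (fun r a => x r ^ a) (by simp),
    Finsupp.prod_single_index (by simp)]

theorem sum_single_smul {A : Type*} [AddCommGroup A] {e : ℕ} (u : Fin e → A) (j : Fin e) (k : ℕ) :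
    ∑ r, (Finsupp.single j k : Fin e →₀ ℕ) r • u r = k • u j := by
  rw [← Finsupp.sum_fintype (Finsupp.single j k) (fun r a => a • u r) (by simp),
    Finsupp.sum_single_index (by simp)]

theorem dvd_mul_sub_of_add_eq {A : Type*} [CommRing A] [Algebra K A] {e : ℕ}
    {u : Fin e → ℤ × ℤ} {t : A} {x : Fin e → A}
    (hx : ∀ f ∈ toricIdeal K u, t ∣ MvPolynomial.aeval x f) {j k : Fin e} {α : Fin e →₀ ℕ}
    (h : u j + u k = ∑ r, α r • u r) : t ∣ x j * x k - ∏ r, x r ^ α r := by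
  have := dvd_monomial_sub_monomial (α := Finsupp.single j 1 + Finsupp.single k 1) (β := α) hx (by
    simp only [Finsupp.add_apply, add_smul, Finset.sum_add_distrib, sum_single_smul, one_smul, h])
  simpa only [Finsupp.add_apply, pow_add, Finset.prod_mul_distrib, prod_pow_single, pow_one]
    using this

theorem jet_unique (hc : ∀ k, 2 ≤ c k) (hu : ∀ k, u k = hjSeq c k) {i : Fin n} {m s l : ℕ}
    (hs : s ≤ m + 1) (hl : l ≤ m + 1)
    {x y : Fin (n + 2) → PowerSeries R}
    (hx : ∀ f ∈ toricIdeal K u, PowerSeries.X ^ (m + 1) ∣ MvPolynomial.aeval x f)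
    (hy : ∀ f ∈ toricIdeal K u, PowerSeries.X ^ (m + 1) ∣ MvPolynomial.aeval y f)
    {U V : (PowerSeries R)ˣ} (hxU : x i.castSucc.succ = PowerSeries.X ^ s * (U : PowerSeries R))
    (hyU : y i.castSucc.succ = PowerSeries.X ^ s * (U : PowerSeries R))
    (hxV : x i.succ.succ = PowerSeries.X ^ l * (V : PowerSeries R))
    (hyV : y i.succ.succ = PowerSeries.X ^ l * (V : PowerSeries R))
    (hxy : ∀ j b, freeFrom i m s l j ≤ b →
      PowerSeries.coeff b (x j) = PowerSeries.coeff b (y j)) : x = y := by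
  -- Strong induction on the distance of j from i + 1, the position of x_i; N bounds this distance.
  have main : ∀ N : ℕ, ∀ j : Fin (n + 2), (j : ℤ) - (i + 1) ≤ N → (i + 1 : ℤ) - j ≤ N →
      x j = y j := by
    intro N
    induction N using Nat.strong_induction_on with
    | _ N ih =>
    intro j h1 h2
    by_cases hj1 : j = i.castSucc.succ
    · rw [hj1, hxU, hyU]
    by_cases hj2 : j = i.succ.succ
    · rw [hj2, hxV, hyV]
    by_cases hj3 : j = i.castSucc.castSucc
    · have hrel : u i.succ.succ + u i.castSucc.castSucc =
          ∑ r, (Finsupp.single i.castSucc.succ (c i) : Fin (n + 2) →₀ ℕ) r • u r := by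
        rw [sum_single_smul, hu, hu, hu]
        exact hjSeq_add c i
      have h3 := dvd_mul_sub_of_add_eq hx hrel
      have h4 := dvd_mul_sub_of_add_eq hy hrel
      rw [prod_pow_single, hxV, hxU] at h3
      rw [prod_pow_single, hyV, hyU] at h4
      rw [hj3]
      refine eq_of_X_pow_dvd hl h3 h4 fun b hb => hxy _ _ ?_
      rwa [freeFrom_left]
    have hfree := freeFrom_of_ne i m s l hj1 hj2 hj3
    simp only [Fin.ext_iff, Fin.val_succ, Fin.val_castSucc] at hj1 hj2 hj3
    obtain ⟨α, hα, hsum⟩ : ∃ α : Fin (n + 2) →₀ ℕ, (∀ r, α r ≠ 0 → x r = y r) ∧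
        u i.castSucc.succ + u j = ∑ r, α r • u r := by
      rcases lt_or_gt_of_ne hj1 with h | h
      · obtain ⟨α, hα, hsum⟩ := exists_add_eq_sum (j := j) (k := i.castSucc.succ) hu hc
          (hjSeq_add c) (by simp; omega)
        refine ⟨α, fun r hr => ?_, by rw [add_comm, hsum]⟩
        have := hα r hr
        simp only [Fin.lt_def, Fin.val_succ, Fin.val_castSucc] at this
        exact ih (i + 1 - r) (by omega) r (by omega) (by omega)
      · obtain ⟨α, hα, hsum⟩ := exists_add_eq_sum (j := i.castSucc.succ) (k := j) hu hc
          (hjSeq_add c) (by simp; omega)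
        refine ⟨α, fun r hr => ?_, hsum⟩
        have := hα r hr
        simp only [Fin.lt_def, Fin.val_succ, Fin.val_castSucc] at this
        exact ih (r - (i + 1)) (by omega) r (by omega) (by omega)
    have hprod : ∏ r, x r ^ α r = ∏ r, y r ^ α r := by
      refine Finset.prod_congr rfl fun r _ => ?_
      by_cases hr : α r = 0
      · rw [hr, pow_zero, pow_zero]
      · rw [hα r hr]
    have h3 := dvd_mul_sub_of_add_eq hx hsum
    have h4 := dvd_mul_sub_of_add_eq hy hsum
    rw [hxU] at h3
    rw [hyU, ← hprod] at h4
    exact eq_of_X_pow_dvd hs h3 h4 fun b hb => hxy _ _ (by rwa [hfree])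
  funext j
  exact main (n + 2) j (by omega) (by omega)

end Unique

/-! ### Existence of the jet with given free coefficients -/

/-- Apply the convex recurrence to the right of position i + 1 (giving b = 0) or, reversed, to the
left of it (giving a = 0). -/
theorem exists_hjSeq_coords {n : ℕ} {c : ℕ → ℕ} (hc : ∀ k, 2 ≤ c k) (i : Fin n)
    (j : Fin (n + 2)) : ∃ d a b : ℕ, 1 ≤ d ∧
      hjSeq c j = d • hjSeq c (i + 1) + a • (hjSeq c (i + 2) - hjSeq c (i + 1)) +
        b • ((c i - 2) • hjSeq c (i + 1) - (hjSeq c (i + 2) - hjSeq c (i + 1))) ∧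
      (j = i.castSucc.succ → d = 1 ∧ a = 0 ∧ b = 0) ∧
      (j = i.succ.succ → d = 1 ∧ a = 1 ∧ b = 0) ∧
      (j = i.castSucc.castSucc → d = 1 ∧ a = 0 ∧ b = 1) := by
  have hleft : hjSeq c i - hjSeq c (i + 1) =
      (c i - 2) • hjSeq c (i + 1) - (hjSeq c (i + 2) - hjSeq c (i + 1)) := by
    have := hjSeq_add c i
    obtain ⟨r, hr⟩ := Nat.exists_eq_add_of_le (hc i)
    rw [hr, add_smul, two_smul] at this
    rw [hr, Nat.add_sub_cancel_left, eq_sub_of_add_eq' this]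
    abel
  rw [← hleft]
  by_cases hj1 : j = i.castSucc.succ
  · subst hj1
    exact ⟨1, 0, 0, le_rfl, by simp, by simp, by simp [Fin.ext_iff], by simp [Fin.ext_iff]⟩
  by_cases hj2 : j = i.succ.succ
  · subst hj2
    exact ⟨1, 1, 0, le_rfl, by simp, by simp [Fin.ext_iff], by simp, by simp [Fin.ext_iff]; omega⟩
  by_cases hj3 : j = i.castSucc.castSucc
  · subst hj3
    exact ⟨1, 0, 1, le_rfl, by simp, by simp [Fin.ext_iff], by simp [Fin.ext_iff]; omega, by simp⟩
  rcases le_total (i + 1 : ℕ) j with h | h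
  · obtain ⟨r, hr⟩ := Nat.exists_eq_add_of_le h
    obtain ⟨d, a, hd, hda⟩ := exists_coords_of_recurrence (w := fun k => hjSeq c (i + 1 + k))
      (c := fun k => c (i + 1 + k)) (N := r) (fun k => hc _)
      (fun k _ => hjSeq_add c (i + 1 + k)) (k := r) (by omega)
    refine ⟨d, a, 0, hd, ?_, fun h => (hj1 h).elim, fun h => (hj2 h).elim, fun h => (hj3 h).elim⟩
    rw [hr, zero_smul, add_zero]
    exact hda
  · obtain ⟨r, hr⟩ := Nat.exists_eq_add_of_le h
    obtain ⟨d, a, hd, hda⟩ := exists_coords_of_recurrence (w := fun k => hjSeq c (i + 1 - k))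
      (c := fun k => c (i - 1 - k)) (N := i) (fun k => hc _)
      (fun k hk => by
        have := hjSeq_add c (i - 1 - k)
        rw [show (i + 1 - (k + 2) : ℕ) = i - 1 - k by omega,
          show (i + 1 - (k + 1) : ℕ) = i - 1 - k + 1 by omega,
          show (i + 1 - k : ℕ) = i - 1 - k + 2 by omega, add_comm, this]) (k := r) (by omega)
    refine ⟨d, 0, a, hd, ?_, fun h => (hj1 h).elim, fun h => (hj2 h).elim, fun h => (hj3 h).elim⟩
    rw [zero_smul, add_zero, show (j : ℕ) = i + 1 - r by omega]
    exact hda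

theorem exists_jet {K : Type*} [Field K] {R : Type*} [CommRing R] [Algebra K R] {n : ℕ}
    {c : ℕ → ℕ} {u : Fin (n + 2) → ℤ × ℤ} (hc : ∀ k, 2 ≤ c k) (hu : ∀ k, u k = hjSeq c k)
    (hirr : ∀ α β : Fin (n + 2) →₀ ℕ, α.degree ≤ 1 → ∑ k, α k • u k = ∑ k, β k • u k → α = β)
    {i : Fin n} {m s l : ℕ} (h2s : 2 * s ≤ m + 1) (hsl : s ≤ l) (hlc : l ≤ (c i - 1) * s)
    (hls : s + l ≤ m + 1) (g : Fin (n + 2) → ℕ → R) (hA : IsUnit (g i.castSucc.succ s))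
    (hB : IsUnit (g i.succ.succ l)) (hl : l ≤ m) :
    ∃ x : Fin (n + 2) → PowerSeries R,
      (∀ j b, freeFrom i m s l j ≤ b → b ≤ m → PowerSeries.coeff b (x j) = g j b) ∧
      (∀ j b, m < b → PowerSeries.coeff b (x j) = 0) ∧
      (∀ b < s, PowerSeries.coeff b (x i.castSucc.succ) = 0) ∧
      (∀ b < l, PowerSeries.coeff b (x i.succ.succ) = 0) ∧
      ∀ f ∈ toricIdeal K u, PowerSeries.X ^ (m + 1) ∣ MvPolynomial.aeval x f := by
  obtain ⟨k, hk⟩ := Nat.exists_eq_add_of_le (hc i)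
  have hTdvd : PowerSeries.X ^ s ∣ glue m s 0 (g i.castSucc.succ) :=
    X_pow_dvd_glue _ le_rfl (dvd_zero _)
  have hSdvd : PowerSeries.X ^ l ∣ glue m l 0 (g i.succ.succ) :=
    X_pow_dvd_glue _ le_rfl (dvd_zero _)
  obtain ⟨U, hU⟩ := exists_eq_X_pow_mul_unit hTdvd
    (by rwa [coeff_glue le_rfl (by omega)])
  obtain ⟨V, hV⟩ := exists_eq_X_pow_mul_unit hSdvd (by rwa [coeff_glue le_rfl hl])
  obtain ⟨r, hr⟩ := Nat.exists_eq_add_of_le hsl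
  obtain ⟨M, hM⟩ := Nat.exists_eq_add_of_le h2s
  -- Here l ≤ (c_i - 1)s enters: T^{c_i}/S has order c_i s - l = s + o, so F is a power series
  -- divisible by X^s.
  obtain ⟨o, ho⟩ : ∃ o, (2 + k) * s = l + s + o := by
    refine Nat.exists_eq_add_of_le ?_
    rw [hk, show 2 + k - 1 = 1 + k by omega] at hlc
    calc l + s ≤ (1 + k) * s + s := by omega
      _ = (2 + k) * s := by ring
  let T := glue m s 0 (g i.castSucc.succ)
  let S := glue m l 0 (g i.succ.succ)
  let F : PowerSeries R := PowerSeries.X ^ (s + o) * (U : PowerSeries R) ^ (2 + k) *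
    (↑V⁻¹ : PowerSeries R)
  let L := glue m (m + 1 - l) F (g i.castSucc.castSucc)
  have hSF : S * F = T ^ (2 + k) := by
    change glue m l 0 (g i.succ.succ) * F = glue m s 0 (g i.castSucc.succ) ^ (2 + k)
    rw [hU, hV, mul_pow, ← pow_mul, mul_comm s, ho]
    calc PowerSeries.X ^ l * (V : PowerSeries R) * (PowerSeries.X ^ (s + o) * (U : PowerSeries R) ^ (2 + k) *
    (↑V⁻¹ : PowerSeries R))
        = PowerSeries.X ^ (l + s + o) * (U : PowerSeries R) ^ (2 + k) *
          ((V : PowerSeries R) * (↑V⁻¹ : PowerSeries R)) := by ring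
      _ = _ := by rw [Units.mul_inv, mul_one]
  have hTU : ∀ f : PowerSeries R, T * ((↑U⁻¹ : PowerSeries R) * f) = PowerSeries.X ^ s * f := by
    intro f
    change glue m s 0 (g i.castSucc.succ) * _ = _
    rw [hU, mul_assoc, Units.mul_inv_cancel_left]
  have hcancel : ∀ {N : ℕ} {f : PowerSeries R}, PowerSeries.X ^ (s + N) ∣ T * f →
      PowerSeries.X ^ N ∣ f := by
    intro N f h
    change _ ∣ glue m s 0 (g i.castSucc.succ) * f at h
    rw [hU] at h
    exact X_pow_dvd_of_mul U.isUnit h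
  obtain ⟨ρ, hρ⟩ : ∃ ρ, S = T * ρ := by
    refine ⟨(↑U⁻¹ : PowerSeries R) * (PowerSeries.X ^ r * (V : PowerSeries R)), ?_⟩
    rw [hTU, ← mul_assoc, ← pow_add, ← hr]
    exact hV
  obtain ⟨π, hπ⟩ : ∃ π, L = T * π := by
    obtain ⟨w, hw⟩ : PowerSeries.X ^ s ∣ L := by
      refine X_pow_dvd_glue _ (by omega) ?_
      simp only [F]
      rw [pow_add, mul_assoc, mul_assoc]
      exact dvd_mul_right _ _
    exact ⟨(↑U⁻¹ : PowerSeries R) * w, by rw [hTU, hw]⟩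
  -- T²(T^k - ρπ) = -S(L - F) has order at least l + (m + 1 - l) = 2s + M, and cancelling T twice
  -- leaves M.
  have hrel : PowerSeries.X ^ M ∣ T ^ k - ρ * π := by
    apply hcancel
    apply hcancel
    have : T * (T * (T ^ k - ρ * π)) = - (S * (L - F)) := by
      rw [mul_sub S, hSF, pow_add, hρ, hπ]
      ring
    rw [this, dvd_neg, show s + (s + M) = l + (m + 1 - l) by omega, pow_add]
    exact mul_dvd_mul hSdvd (X_pow_dvd_glue_sub _ _ _ _)
  choose d a b hd hcoords hmid hright hleft using exists_hjSeq_coords hc i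
  let x : Fin (n + 2) → PowerSeries R := fun j =>
    if j = i.castSucc.succ then T else if j = i.succ.succ then S
    else if j = i.castSucc.castSucc then L
    else glue m (m + 1 - s) (T * (T ^ (d j - 1) * ρ ^ a j * π ^ b j)) (g j)
  have hx1 : x i.castSucc.succ = T := by simp [x]
  have hx2 : x i.succ.succ = S := by simp [x, Fin.ext_iff]
  have hx3 : x i.castSucc.castSucc = L := by simp [x, Fin.ext_iff]; omega
  have hz : ∀ j, ∃ z, x j = T * z ∧
      PowerSeries.X ^ M ∣ z - T ^ (d j - 1) * ρ ^ a j * π ^ b j := by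
    intro j
    by_cases h1 : j = i.castSucc.succ
    · obtain ⟨hd', ha', hb'⟩ := hmid j h1
      exact ⟨1, by rw [h1, hx1, mul_one], by simp [hd', ha', hb']⟩
    by_cases h2 : j = i.succ.succ
    · obtain ⟨hd', ha', hb'⟩ := hright j h2
      exact ⟨ρ, by rw [h2, hx2, hρ], by simp [hd', ha', hb']⟩
    by_cases h3 : j = i.castSucc.castSucc
    · obtain ⟨hd', ha', hb'⟩ := hleft j h3
      exact ⟨π, by rw [h3, hx3, hπ], by simp [hd', ha', hb']⟩
    have hxj : x j = glue m (m + 1 - s) (T * (T ^ (d j - 1) * ρ ^ a j * π ^ b j)) (g j) := by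
      simp only [x, if_neg h1, if_neg h2, if_neg h3]
    obtain ⟨w, hw⟩ : PowerSeries.X ^ s ∣ x j := by
      rw [hxj]
      exact X_pow_dvd_glue _ (by omega) (hTdvd.mul_right _)
    refine ⟨(↑U⁻¹ : PowerSeries R) * w, by rw [hTU, hw], hcancel ?_⟩
    rw [mul_sub, hTU, ← hw, hxj, show s + M = m + 1 - s by omega]
    exact X_pow_dvd_glue_sub _ _ _ _
  choose z hxz hz using hz
  refine ⟨x, ?_, ?_, ?_, ?_, ?_⟩
  · intro j b' hj hb
    by_cases h1 : j = i.castSucc.succ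
    · subst h1
      rw [freeFrom_mid] at hj
      rw [hx1]
      exact coeff_glue hj hb
    by_cases h2 : j = i.succ.succ
    · subst h2
      rw [freeFrom_right] at hj
      rw [hx2]
      exact coeff_glue hj hb
    by_cases h3 : j = i.castSucc.castSucc
    · subst h3
      rw [freeFrom_left] at hj
      rw [hx3]
      exact coeff_glue hj hb
    rw [freeFrom_of_ne i m s l h1 h2 h3] at hj
    simp only [x, if_neg h1, if_neg h2, if_neg h3]
    exact coeff_glue hj hb
  · intro j b' hb
    simp only [x]
    split_ifs <;> exact coeff_glue_of_lt (by omega) hb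
  · rw [hx1]
    exact PowerSeries.X_pow_dvd_iff.1 hTdvd
  · rw [hx2]
    exact PowerSeries.X_pow_dvd_iff.1 hSdvd
  · intro f hf
    rw [← Ideal.mem_span_singleton]
    refine aeval_mem_of_mem_toricIdeal (fun α β hαβ => ?_) hf
    rw [Ideal.mem_span_singleton]
    by_cases hα : α.degree ≤ 1
    · rw [hirr α β hα hαβ, sub_self]
      exact dvd_zero _
    by_cases hβ : β.degree ≤ 1
    · rw [hirr β α hβ hαβ.symm, sub_self]
      exact dvd_zero _
    have hdet := hjSeq_det c (i + 1)
    have key := dvd_prod_sub_prod (u := u) (P := hjSeq c (i + 1)) (Q := hjSeq c (i + 2))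
      hd hrel hz (by rw [show (i : ℕ) + 1 + 1 = i + 2 by omega] at hdet; omega) (fun j => by
        rw [hu, hcoords j, hk, Nat.add_sub_cancel_left]) (by omega) (by omega) hαβ
    simp only [← hxz] at key
    refine dvd_trans ?_ key
    -- T² contributes X^{2s} and the congruence of the cofactors X^M, in total X^{m+1}.
    rw [hM, pow_add, pow_mul']
    exact mul_dvd_mul_right (pow_dvd_pow_of_dvd hTdvd 2) _

/-! ### Graphs over localized polynomial rings -/

/-- Turns scheme-theoretic points into jets over a field, where a nonzero leading coefficient is a
unit. -/
theorem exists_algHom_field_ker.{v, w} (K : Type v) [Field K] {A : Type w} [CommRing A] [Algebra K A]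
    (𝔮 : Ideal A) [𝔮.IsPrime] : ∃ (κ : Type w) (_ : Field κ) (_ : Algebra K κ) (ev : A →ₐ[K] κ),
      ∀ f, ev f = 0 ↔ f ∈ 𝔮 := by
  refine ⟨FractionRing (A ⧸ 𝔮), inferInstance, inferInstance,
    (IsScalarTower.toAlgHom K (A ⧸ 𝔮) _).comp (Ideal.Quotient.mkₐ K 𝔮), fun f => ?_⟩
  rw [← Ideal.Quotient.eq_zero_iff_mem]
  exact (IsFractionRing.injective (A ⧸ 𝔮) (FractionRing (A ⧸ 𝔮))).eq_iff' (map_zero _)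

section Graph

variable {K : Type*} [Field K] {ι : Type*} {F : ι → Prop} {P : Type*} [CommRing P] [Algebra K P]
  [Algebra (MvPolynomial {k // F k} K) P] [IsScalarTower K (MvPolynomial {k // F k} K) P]
  {d : MvPolynomial {k // F k} K} {θ : MvPolynomial ι K →ₐ[K] P}

theorem apply_rename_val
    (hθ : ∀ k : {k // F k}, θ (MvPolynomial.X k) =
      algebraMap (MvPolynomial {k // F k} K) P (MvPolynomial.X k))
    (g : MvPolynomial {k // F k} K) :
    θ (MvPolynomial.rename Subtype.val g) = algebraMap _ P g := by
  have : θ.comp (MvPolynomial.rename Subtype.val) =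
      IsScalarTower.toAlgHom K (MvPolynomial {k // F k} K) P := by
    apply MvPolynomial.algHom_ext
    intro k
    simpa using hθ k
  exact DFunLike.congr_fun this g

theorem exists_algHom_of_isUnit [IsLocalization.Away d P] {A : Type*} [CommRing A] [Algebra K A]
    (ev : MvPolynomial ι K →ₐ[K] A) (hd : IsUnit (ev (MvPolynomial.rename Subtype.val d))) :
    ∃ ψ : P →ₐ[K] A, ∀ g : MvPolynomial {k // F k} K,
      ψ (algebraMap _ P g) = ev (MvPolynomial.rename Subtype.val g) := by
  let f : MvPolynomial {k // F k} K →ₐ[K] A := ev.comp (MvPolynomial.rename Subtype.val)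
  have hf : ∀ y : Submonoid.powers d, IsUnit (f y) := by
    rintro ⟨_, r, rfl⟩
    simpa [f] using hd.pow r
  refine ⟨IsLocalization.liftAlgHom (M := Submonoid.powers d) (S := P) (f := f) hf, fun g => ?_⟩
  rw [IsLocalization.liftAlgHom_apply]
  exact IsLocalization.lift_eq _ g

/-- Clearing denominators gives one equation per dependent variable. The graph is a component of
their common zero set, and Krull's height theorem bounds its height. -/
theorem height_ker_le [IsDomain P] [Finite ι] [IsLocalization.Away d P]
    (hθ : ∀ k : {k // F k}, θ (MvPolynomial.X k) =
      algebraMap (MvPolynomial {k // F k} K) P (MvPolynomial.X k)) :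
    (RingHom.ker θ).height ≤ Nat.card {k // ¬ F k} := by
  have hdunit : IsUnit (algebraMap _ P d) := IsLocalization.Away.algebraMap_isUnit d
  have hg : ∀ k : {k // ¬ F k}, ∃ (r : ℕ) (g : MvPolynomial {k // F k} K),
      θ (MvPolynomial.X k) * algebraMap _ P d ^ r = algebraMap _ P g := fun k => by
    obtain ⟨r, g, h⟩ := IsLocalization.Away.surj d (θ (MvPolynomial.X (k : ι)))
    exact ⟨r, g, h⟩
  choose r g hg using hg
  let t : {k // ¬ F k} → MvPolynomial ι K := fun k =>
    MvPolynomial.X (k : ι) * MvPolynomial.rename Subtype.val d ^ r k -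
      MvPolynomial.rename Subtype.val (g k)
  have hmin : RingHom.ker θ ∈ (Ideal.span (Set.range t)).minimalPrimes := by
    refine ⟨⟨RingHom.ker_isPrime _, ?_⟩, ?_⟩
    · rw [Ideal.span_le]
      rintro _ ⟨k, rfl⟩
      simp [t, RingHom.mem_ker, apply_rename_val hθ, hg]
    -- A smaller prime containing the equations does not contain d. So its residue point is
    -- determined by the free coordinates and factors through θ.
    · rintro 𝔮 ⟨h𝔮, ht⟩ hle f hf
      obtain ⟨κ, _, _, ev, hev⟩ := exists_algHom_field_ker K 𝔮
      have hd : IsUnit (ev (MvPolynomial.rename Subtype.val d)) := by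
        rw [isUnit_iff_ne_zero, Ne, hev]
        intro h
        have := hle h
        rw [RingHom.mem_ker, apply_rename_val hθ] at this
        exact hdunit.ne_zero this
      obtain ⟨ψ, hψ⟩ := exists_algHom_of_isUnit (P := P) ev hd
      have hcomp : ψ.comp θ = ev := by
        apply MvPolynomial.algHom_ext
        intro k
        rw [AlgHom.comp_apply]
        by_cases hk : F k
        · rw [hθ ⟨k, hk⟩, hψ, MvPolynomial.rename_X]
        · have h1 := congrArg ψ (hg ⟨k, hk⟩)
          rw [map_mul, map_pow, hψ, hψ] at h1
          have h2 : ev (t ⟨k, hk⟩) = 0 := (hev _).2 (ht (Ideal.subset_span ⟨_, rfl⟩))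
          simp only [t, map_sub, map_mul, map_pow] at h2
          rw [sub_eq_zero] at h2
          exact (hd.pow _).mul_right_cancel (h1.trans h2.symm)
      rw [← hev, ← hcomp, AlgHom.comp_apply, (RingHom.mem_ker).1 hf, map_zero]
  have hfin : (Set.range t).Finite := Set.finite_range t
  have := Fintype.ofFinite {k // ¬ F k}
  refine (Ideal.height_le_card_of_mem_minimalPrimes_span hfin hmin).trans ?_
  rw [Nat.cast_le, ← Set.image_univ]
  refine (Set.ncard_image_le Set.finite_univ).trans ?_
  rw [Set.ncard_univ]

/-- The dependent coordinates are released by adding independent variables to their graph values.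
Imposing the graph equations one at a time gives a strictly increasing chain of primes ending at the
kernel of θ. -/
theorem le_height_ker [IsDomain P] [Finite ι] [IsLocalization.Away d P]
    (hθ : ∀ k : {k // F k}, θ (MvPolynomial.X k) =
      algebraMap (MvPolynomial {k // F k} K) P (MvPolynomial.X k)) :
    Nat.card {k // ¬ F k} ≤ (RingHom.ker θ).height := by
  classical
  have hdunit : IsUnit (algebraMap _ P d) := IsLocalization.Away.algebraMap_isUnit d
  let Θ : Finset {k // ¬ F k} → MvPolynomial ι K →ₐ[K] MvPolynomial {k // ¬ F k} P := fun T =>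
    MvPolynomial.aeval fun k => MvPolynomial.C (θ (MvPolynomial.X k)) +
      if h : ¬ F k then if ⟨k, h⟩ ∈ T then 0 else MvPolynomial.X ⟨k, h⟩ else 0
  have hΘ : ∀ T k, Θ T (MvPolynomial.X k) = MvPolynomial.C (θ (MvPolynomial.X k)) +
      if h : ¬ F k then if ⟨k, h⟩ ∈ T then 0 else MvPolynomial.X ⟨k, h⟩ else 0 := fun T k =>
    MvPolynomial.aeval_X _ _
  have hΘF : ∀ T g, Θ T (MvPolynomial.rename Subtype.val g) =
      MvPolynomial.C (algebraMap (MvPolynomial {k // F k} K) P g) := by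
    intro T g
    have : (Θ T).comp (MvPolynomial.rename Subtype.val) =
        (IsScalarTower.toAlgHom K P (MvPolynomial {k // ¬ F k} P)).comp
          (IsScalarTower.toAlgHom K (MvPolynomial {k // F k} K) P) := by
      apply MvPolynomial.algHom_ext
      intro k
      simp [hΘ, k.2, hθ, MvPolynomial.algebraMap_eq]
    simpa [MvPolynomial.algebraMap_eq] using DFunLike.congr_fun this g
  have hprime : ∀ T, (RingHom.ker (Θ T)).IsPrime := fun T => RingHom.ker_isPrime _
  have hlt : ∀ T k, k ∉ T → RingHom.ker (Θ T) < RingHom.ker (Θ (insert k T)) := by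
    intro T k hk
    let σ : MvPolynomial {k // ¬ F k} P →ₐ[P] MvPolynomial {k // ¬ F k} P :=
      MvPolynomial.aeval fun j => if j = k then 0 else MvPolynomial.X j
    have hσ : Θ (insert k T) = (σ.restrictScalars K).comp (Θ T) := by
      apply MvPolynomial.algHom_ext
      intro j
      rw [AlgHom.comp_apply, hΘ, hΘ]
      by_cases hj : F j
      · simp [hj, σ]
      · by_cases hjk : (⟨j, hj⟩ : {k // ¬ F k}) = k
        · simp [hj, σ, hjk, hk]
        · by_cases hjT : (⟨j, hj⟩ : {k // ¬ F k}) ∈ T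
          · simp [hj, σ, hjT]
          · simp [hj, σ, hjk, hjT]
    refine lt_of_le_of_ne (fun f hf => ?_) fun h => ?_
    · rw [RingHom.mem_ker] at hf ⊢
      rw [hσ, AlgHom.comp_apply, hf, map_zero]
    · obtain ⟨r, g, hg⟩ := IsLocalization.Away.surj d (θ (MvPolynomial.X (k : ι)))
      -- The cleared equation of the coordinate k separates the two primes: before k is imposed, its
      -- image is the variable of k times a power of d.
      have h1 : MvPolynomial.X (k : ι) * MvPolynomial.rename Subtype.val d ^ r -
          MvPolynomial.rename Subtype.val g ∈ RingHom.ker (Θ (insert k T)) := by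
        rw [RingHom.mem_ker, map_sub, map_mul, map_pow, hΘF, hΘF, hΘ]
        simp [k.2, ← hg]
      rw [← h, RingHom.mem_ker, map_sub, map_mul, map_pow, hΘF, hΘF, hΘ, ← hg] at h1
      simp only [k.2, not_false_iff, dite_true, hk, if_false, map_mul, map_pow, add_mul,
        add_sub_cancel_left] at h1
      rcases mul_eq_zero.1 h1 with h2 | h2
      · exact MvPolynomial.X_ne_zero _ h2
      · exact (((hdunit.map MvPolynomial.C).pow r).ne_zero h2)
  have hcard : ∀ T : Finset {k // ¬ F k}, (T.card : ℕ∞) ≤ (RingHom.ker (Θ T)).height := by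
    intro T
    induction T using Finset.induction_on with
    | empty => simp
    | insert k T hk ih =>
      rw [Finset.card_insert_of_notMem hk]
      have := Ideal.height_add_one_le_of_lt_of_isPrime (hlt T k hk)
      push_cast
      exact (add_le_add_left ih 1).trans this
  have := Fintype.ofFinite {k // ¬ F k}
  have huniv : RingHom.ker (Θ Finset.univ) = RingHom.ker θ := by
    have : Θ Finset.univ = (IsScalarTower.toAlgHom K P (MvPolynomial {k // ¬ F k} P)).comp θ := by
      apply MvPolynomial.algHom_ext
      intro k
      simp [hΘ, MvPolynomial.algebraMap_eq]
    ext f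
    rw [RingHom.mem_ker, RingHom.mem_ker, this, AlgHom.comp_apply]
    simp [MvPolynomial.algebraMap_eq]
  have h := hcard Finset.univ
  rwa [huniv, Finset.card_univ, ← Nat.card_eq_fintype_card] at h

/-- The free polynomial ring already maps onto P up to powers of d, and the quotient by the kernel
of θ embeds in P; so P is also the localization of that quotient. -/
theorem exists_algEquiv_localization [IsLocalization.Away d P]
    (hθ : ∀ k : {k // F k}, θ (MvPolynomial.X k) =
      algebraMap (MvPolynomial {k // F k} K) P (MvPolynomial.X k))
    {I : Ideal (MvPolynomial ι K)} (hI : I = RingHom.ker θ) {f : MvPolynomial ι K}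
    (hf : f = MvPolynomial.rename Subtype.val d) :
    ∃ φ : Localization.Away (Ideal.Quotient.mk I f) ≃ₐ[K] P,
      ∀ g, φ (algebraMap _ _ (Ideal.Quotient.mk I g)) = θ g := by
  subst hI hf
  let θ' : (MvPolynomial ι K ⧸ RingHom.ker θ) →ₐ[K] P := Ideal.kerLiftAlg θ
  have hθ' : ∀ g, θ' (Ideal.Quotient.mk _ g) = θ g := fun g => Ideal.kerLiftAlg_mk θ g
  let _ : Algebra (MvPolynomial ι K ⧸ RingHom.ker θ) P := θ'.toRingHom.toAlgebra
  have hmap : ∀ x, algebraMap (MvPolynomial ι K ⧸ RingHom.ker θ) P x = θ' x := fun _ => rfl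
  have : IsScalarTower K (MvPolynomial ι K ⧸ RingHom.ker θ) P :=
    IsScalarTower.of_algebraMap_eq (R := K) (S := MvPolynomial ι K ⧸ RingHom.ker θ) fun k => by
      rw [hmap, AlgHom.commutes]
  have : IsLocalization.Away
      (Ideal.Quotient.mk (RingHom.ker θ) (MvPolynomial.rename Subtype.val d)) P := by
    constructor
    refine ⟨?_, ?_, ?_⟩
    · rintro ⟨_, r, rfl⟩
      simp only [hmap, map_pow]
      rw [hθ', apply_rename_val hθ]
      exact (IsLocalization.Away.algebraMap_isUnit d).pow r
    · intro z
      obtain ⟨r, g, hg⟩ := IsLocalization.Away.surj d z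
      refine ⟨⟨Ideal.Quotient.mk _ (MvPolynomial.rename Subtype.val g), _, r, rfl⟩, ?_⟩
      simp only [hmap, map_pow]
      rw [hθ', hθ', apply_rename_val hθ, apply_rename_val hθ, hg]
    · intro x y hxy
      exact ⟨1, by rw [Ideal.kerLiftAlg_injective θ hxy]⟩
  let φ := IsLocalization.algEquiv (Submonoid.powers
    (Ideal.Quotient.mk (RingHom.ker θ) (MvPolynomial.rename Subtype.val d)))
    (Localization.Away (Ideal.Quotient.mk (RingHom.ker θ) (MvPolynomial.rename Subtype.val d))) P
  refine ⟨φ.restrictScalars K, fun g => ?_⟩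
  rw [AlgEquiv.restrictScalars_apply, AlgEquiv.commutes, hmap, hθ']

end Graph

/-! ### Closure, vanishing ideal and codimension in the spectrum -/

section Topology

variable {A : Type*} [CommRing A]

theorem closure_eq_zeroLocus {𝔭 : Ideal A} [h𝔭 : 𝔭.IsPrime] {f : A} (hf : f ∉ 𝔭)
    {Z : Set (PrimeSpectrum A)} (hZ : ∀ γ, γ ∈ Z ↔ 𝔭 ≤ γ.asIdeal ∧ f ∉ γ.asIdeal) :
    closure Z = PrimeSpectrum.zeroLocus 𝔭 := by
  apply Set.Subset.antisymm
  · exact closure_minimal (fun γ hγ => ((hZ γ).1 hγ).1) (PrimeSpectrum.isClosed_zeroLocus _)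
  · have := PrimeSpectrum.closure_singleton (⟨𝔭, h𝔭⟩ : PrimeSpectrum A)
    rw [← this]
    refine closure_mono ?_
    rw [Set.singleton_subset_iff, hZ]
    exact ⟨le_rfl, hf⟩

theorem vanishingIdeal_eq {𝔭 : Ideal A} [h𝔭 : 𝔭.IsPrime] {f : A} (hf : f ∉ 𝔭)
    {Z : Set (PrimeSpectrum A)} (hZ : ∀ γ, γ ∈ Z ↔ 𝔭 ≤ γ.asIdeal ∧ f ∉ γ.asIdeal) :
    PrimeSpectrum.vanishingIdeal Z = 𝔭 := by
  rw [← PrimeSpectrum.vanishingIdeal_closure, closure_eq_zeroLocus hf hZ,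
    PrimeSpectrum.vanishingIdeal_zeroLocus_eq_radical, h𝔭.radical]

theorem codim_eq_height {𝔭 : Ideal A} [h𝔭 : 𝔭.IsPrime] {Z : Set (PrimeSpectrum A)}
    (hZ : Z = PrimeSpectrum.zeroLocus 𝔭) (hirr : IsIrreducible Z) (hcl : IsClosed Z) :
    codim (⟨Z, hirr, hcl⟩ : TopologicalSpace.IrreducibleCloseds (PrimeSpectrum A)) =
      𝔭.height := by
  subst hZ
  -- Primes correspond to irreducible closed sets with inclusion reversed, so height becomes
  -- coheight.
  have h := Order.height_orderIso (PrimeSpectrum.pointsEquivIrreducibleCloseds A) ⟨𝔭, h𝔭⟩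
  rw [← PrimeSpectrum.height_eq_orderHeight] at h
  have hη : OrderDual.toDual (⟨PrimeSpectrum.zeroLocus 𝔭, hirr, hcl⟩ :
      TopologicalSpace.IrreducibleCloseds (PrimeSpectrum A)) =
        PrimeSpectrum.pointsEquivIrreducibleCloseds A ⟨𝔭, h𝔭⟩ :=
    congrArg OrderDual.toDual (TopologicalSpace.IrreducibleCloseds.ext
      (PrimeSpectrum.closure_singleton (⟨𝔭, h𝔭⟩ : PrimeSpectrum A)).symm)
  rw [codim, ← h, ← Order.height_toDual, hη]

end Topology

/-! ### Inverting two variables of a polynomial ring -/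

theorem exists_isLocalization_mvPolynomial (K : Type*) [Field K] {κ : Type*} [Finite κ] {a b : κ}
    (hab : a ≠ b) : ∃ (N : ℕ) (_ : Algebra (MvPolynomial κ K) (MvPolynomial (Fin N) (TwoVarLoc K))),
      IsScalarTower K (MvPolynomial κ K) (MvPolynomial (Fin N) (TwoVarLoc K)) ∧
      IsLocalization.Away (MvPolynomial.X a * MvPolynomial.X b : MvPolynomial κ K)
        (MvPolynomial (Fin N) (TwoVarLoc K)) ∧
      algebraMap (MvPolynomial κ K) (MvPolynomial (Fin N) (TwoVarLoc K)) (MvPolynomial.X a) =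
        MvPolynomial.C (algebraMap (MvPolynomial (Fin 2) K) _ (MvPolynomial.X 0)) ∧
      algebraMap (MvPolynomial κ K) (MvPolynomial (Fin N) (TwoVarLoc K)) (MvPolynomial.X b) =
        MvPolynomial.C (algebraMap (MvPolynomial (Fin 2) K) _ (MvPolynomial.X 1)) := by
  classical
  obtain ⟨N, e, ha, hb⟩ : ∃ (N : ℕ) (e : κ ≃ Fin N ⊕ Fin 2), e a = Sum.inr 0 ∧ e b = Sum.inr 1 := by
    let f : Fin 2 → κ := ![a, b]
    have hf : Function.Injective f := by
      intro x y h
      fin_cases x <;> fin_cases y <;> simp_all [f]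
    let e := (Equiv.sumComm _ _).trans ((Equiv.sumCongr (Equiv.ofInjective f hf)
      (Finite.equivFin ((Set.range f)ᶜ : Set κ)).symm).trans (Equiv.Set.sumCompl (Set.range f)))
    refine ⟨_, e.symm, ?_, ?_⟩
    · rw [Equiv.symm_apply_eq]; exact rfl
    · rw [Equiv.symm_apply_eq]; exact rfl
  let _ := MvPolynomial.algebraMvPolynomial (σ := Fin N) (R := MvPolynomial (Fin 2) K)
    (S := TwoVarLoc K)
  let P := MvPolynomial (Fin N) (TwoVarLoc K)
  let E : MvPolynomial κ K ≃ₐ[K] MvPolynomial (Fin N) (MvPolynomial (Fin 2) K) :=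
    (MvPolynomial.renameEquiv K e).trans (MvPolynomial.sumAlgEquiv K (Fin N) (Fin 2))
  have hEa : E (MvPolynomial.X a) = MvPolynomial.C (MvPolynomial.X 0) := by
    simp only [E, AlgEquiv.trans_apply, MvPolynomial.renameEquiv_apply, MvPolynomial.rename_X, ha,
      MvPolynomial.sumAlgEquiv_X_inr]
  have hEb : E (MvPolynomial.X b) = MvPolynomial.C (MvPolynomial.X 1) := by
    simp only [E, AlgEquiv.trans_apply, MvPolynomial.renameEquiv_apply, MvPolynomial.rename_X, hb,
      MvPolynomial.sumAlgEquiv_X_inr]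
  let A : Algebra (MvPolynomial κ K) P :=
    ((algebraMap (MvPolynomial (Fin N) (MvPolynomial (Fin 2) K)) P).comp
      (E.symm.toRingEquiv.symm : MvPolynomial κ K ≃+* _).toRingHom).toAlgebra
  have hA : ∀ g, algebraMap (MvPolynomial κ K) P g =
      algebraMap (MvPolynomial (Fin N) (MvPolynomial (Fin 2) K)) P (E g) := fun _ => rfl
  refine ⟨N, A, ?_, ?_, ?_, ?_⟩
  · refine IsScalarTower.of_algebraMap_eq fun k => ?_
    rw [hA, AlgEquiv.commutes, MvPolynomial.algebraMap_apply,
      IsScalarTower.algebraMap_apply K (MvPolynomial (Fin 2) K) (TwoVarLoc K)]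
    exact (MvPolynomial.map_C _ _).symm
  · have h1 := MvPolynomial.isLocalization (σ := Fin N)
      (Submonoid.powers (MvPolynomial.X 0 * MvPolynomial.X 1 : MvPolynomial (Fin 2) K))
      (TwoVarLoc K)
    have h2 := IsLocalization.isLocalization_of_base_ringEquiv
      (Submonoid.map MvPolynomial.C
        (Submonoid.powers (MvPolynomial.X 0 * MvPolynomial.X 1 : MvPolynomial (Fin 2) K)))
      P E.symm.toRingEquiv
    rw [Submonoid.map_powers, Submonoid.map_powers] at h2
    have h3 : E.symm.toRingEquiv (MvPolynomial.C (MvPolynomial.X 0 * MvPolynomial.X 1)) =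
        (MvPolynomial.X a * MvPolynomial.X b : MvPolynomial κ K) := by
      rw [map_mul, ← hEa, ← hEb, ← map_mul]
      exact E.symm_apply_apply _
    have h4 : IsLocalization (Submonoid.powers (E.symm.toRingEquiv
      (MvPolynomial.C (MvPolynomial.X 0 * MvPolynomial.X 1)))) P := h2
    rw [h3] at h4
    exact h4
  · rw [hA, hEa]
    exact MvPolynomial.map_C _ _
  · rw [hA, hEb]
    exact MvPolynomial.map_C _ _

/-! ### The locus `D` as a graph -/

section Loci

variable {K : Type*} [Field K] {n : ℕ} {c : ℕ → ℕ} {u : Fin (n + 2) → ℤ × ℤ} {i : Fin n}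
  {m s l : ℕ}

theorem coeff_evalJet {R : Type*} [CommRing R] [Algebra K R] {e : ℕ} (ev : JetRing K e m →ₐ[K] R)
    (j : Fin e) (b : Fin (m + 1)) :
    PowerSeries.coeff b (evalJet ev j) = ev (MvPolynomial.X (j, b)) := by
  simp [evalJet, b.is_le]

theorem coeff_evalJet_of_lt {R : Type*} [CommRing R] [Algebra K R] {e : ℕ}
    (ev : JetRing K e m →ₐ[K] R) (j : Fin e) {b : ℕ} (hb : m < b) :
    PowerSeries.coeff b (evalJet ev j) = 0 := by
  simp only [evalJet, PowerSeries.coeff_mk]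
  rw [dif_neg (by omega)]

theorem coeff_evalJet_eq_jetCoeff {R : Type*} [CommRing R] [Algebra K R] {e : ℕ}
    (ev : JetRing K e m →ₐ[K] R) (j : Fin e) (b : ℕ) :
    PowerSeries.coeff b (evalJet ev j) = ev (jetCoeff m (MvPolynomial.X j) b) := by
  rw [← coeff_aeval_evalJet, MvPolynomial.aeval_X]

/-- Membership in `D` in terms of the jet given by a homomorphism with kernel the prime ideal. -/
theorem mem_D_iff {R : Type*} [CommRing R] [Algebra K R] {γ : PrimeSpectrum (JetRing K (n + 2) m)}
    (ev : JetRing K (n + 2) m →ₐ[K] R) (hev : ∀ f, ev f = 0 ↔ f ∈ γ.asIdeal) :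
    γ ∈ D K u i m s l ↔
      (∀ f ∈ toricIdeal K u, PowerSeries.X ^ (m + 1) ∣ MvPolynomial.aeval (evalJet ev) f) ∧
      (∀ b < s, PowerSeries.coeff b (evalJet ev i.castSucc.succ) = 0) ∧
      (∀ b < l, PowerSeries.coeff b (evalJet ev i.succ.succ) = 0) ∧
      PowerSeries.coeff s (evalJet ev i.castSucc.succ) ≠ 0 ∧
      PowerSeries.coeff l (evalJet ev i.succ.succ) ≠ 0 := by
  simp only [D, contact, Set.mem_inter_iff, Set.mem_ofPred_eq, PrimeSpectrum.mem_zeroLocus,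
    coeff_evalJet_eq_jetCoeff, Ne, hev, ← jetIdeal_le_ker_iff, Set.subset_def, SetLike.mem_coe]
  tauto

theorem exists_parametrization (hc : ∀ k, 2 ≤ c k) (hu : ∀ k, u k = hjSeq c k)
    (hirr : ∀ α β : Fin (n + 2) →₀ ℕ, α.degree ≤ 1 → ∑ k, α k • u k = ∑ k, β k • u k → α = β)
    (h2s : 2 * s ≤ m + 1) (hsl : s ≤ l) (hlc : l ≤ (c i - 1) * s)
    (hls : s + l ≤ m + 1) (hlm : l ≤ m)
    {a b : {k : Fin (n + 2) × Fin (m + 1) // freeFrom i m s l k.1 ≤ k.2}}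
    (ha : (a : Fin (n + 2) × Fin (m + 1)) = (i.castSucc.succ, ⟨s, by omega⟩))
    (hb : (b : Fin (n + 2) × Fin (m + 1)) = (i.succ.succ, ⟨l, by omega⟩))
    {P : Type*} [CommRing P] [IsDomain P] [Algebra K P]
    [Algebra (MvPolynomial {k : Fin (n + 2) × Fin (m + 1) // freeFrom i m s l k.1 ≤ k.2} K) P]
    [IsScalarTower K
      (MvPolynomial {k : Fin (n + 2) × Fin (m + 1) // freeFrom i m s l k.1 ≤ k.2} K) P]
    [IsLocalization.Away (MvPolynomial.X a * MvPolynomial.X b :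
      MvPolynomial {k : Fin (n + 2) × Fin (m + 1) // freeFrom i m s l k.1 ≤ k.2} K) P] :
    ∃ θ : JetRing K (n + 2) m →ₐ[K] P,
      (∀ k : {k : Fin (n + 2) × Fin (m + 1) // freeFrom i m s l k.1 ≤ k.2},
        θ (MvPolynomial.X k) = algebraMap
          (MvPolynomial {k : Fin (n + 2) × Fin (m + 1) // freeFrom i m s l k.1 ≤ k.2} K) P
            (MvPolynomial.X k)) ∧
      ∀ γ, γ ∈ D K u i m s l ↔
        RingHom.ker θ ≤ γ.asIdeal ∧ coordA K i m s * coordB K i m l ∉ γ.asIdeal := by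
  have hsm : s ≤ m := by omega
  have hunit : IsUnit (algebraMap
      (MvPolynomial {k : Fin (n + 2) × Fin (m + 1) // freeFrom i m s l k.1 ≤ k.2} K) P
        (MvPolynomial.X a * MvPolynomial.X b)) :=
    IsLocalization.Away.algebraMap_isUnit _
  rw [map_mul, IsUnit.mul_iff] at hunit
  let g : Fin (n + 2) → ℕ → P := fun j r =>
    if h : ∃ hr : r < m + 1, freeFrom i m s l j ≤ r then
      algebraMap (MvPolynomial {k : Fin (n + 2) × Fin (m + 1) // freeFrom i m s l k.1 ≤ k.2} K) P
        (MvPolynomial.X ⟨(j, ⟨r, h.1⟩), h.2⟩) else 0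
  have hg : ∀ k : {k : Fin (n + 2) × Fin (m + 1) // freeFrom i m s l k.1 ≤ k.2},
      g k.1.1 k.1.2 = algebraMap
        (MvPolynomial {k : Fin (n + 2) × Fin (m + 1) // freeFrom i m s l k.1 ≤ k.2} K) P
          (MvPolynomial.X k) := fun k => dif_pos ⟨k.1.2.2, k.2⟩
  have hgA : IsUnit (g i.castSucc.succ s) := by
    have := hg a
    rw [ha] at this
    rw [this]
    exact hunit.1
  have hgB : IsUnit (g i.succ.succ l) := by
    have := hg b
    rw [hb] at this
    rw [this]
    exact hunit.2
  obtain ⟨x, hx1, hx2, hx3, hx4, hx5⟩ :=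
    exists_jet (K := K) hc hu hirr h2s hsl hlc hls g hgA hgB hlm
  let θ : JetRing K (n + 2) m →ₐ[K] P := MvPolynomial.aeval fun k => PowerSeries.coeff k.2 (x k.1)
  have hθx : evalJet θ = x := by
    funext j
    ext r
    by_cases hr : r < m + 1
    · have := coeff_evalJet θ j ⟨r, hr⟩
      simp only [θ, MvPolynomial.aeval_X] at this
      exact this
    · rw [coeff_evalJet_of_lt _ _ (by omega), hx2 _ _ (by omega)]
  have hθ : ∀ k : {k : Fin (n + 2) × Fin (m + 1) // freeFrom i m s l k.1 ≤ k.2},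
      θ (MvPolynomial.X k) = algebraMap
        (MvPolynomial {k : Fin (n + 2) × Fin (m + 1) // freeFrom i m s l k.1 ≤ k.2} K) P
          (MvPolynomial.X k) := by
    intro k
    simp only [θ, MvPolynomial.aeval_X]
    rw [hx1 _ _ k.2 k.1.2.is_le, hg]
  have hA : coordA K i m s = MvPolynomial.X (i.castSucc.succ, ⟨s, by omega⟩) :=
    jetCoeff_X _ (⟨s, by omega⟩ : Fin (m + 1))
  have hB : coordB K i m l = MvPolynomial.X (i.succ.succ, ⟨l, by omega⟩) :=
    jetCoeff_X _ (⟨l, by omega⟩ : Fin (m + 1))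
  refine ⟨θ, hθ, fun γ => ?_⟩
  obtain ⟨κ, _, _, ev, hev⟩ := exists_algHom_field_ker K γ.asIdeal
  have hevA : PowerSeries.coeff s (evalJet ev i.castSucc.succ) = ev (coordA K i m s) :=
    coeff_evalJet_eq_jetCoeff _ _ _
  have hevB : PowerSeries.coeff l (evalJet ev i.succ.succ) = ev (coordB K i m l) :=
    coeff_evalJet_eq_jetCoeff _ _ _
  rw [mem_D_iff ev hev, γ.isPrime.mul_mem_iff_mem_or_mem, not_or, hevA, hevB, Ne, Ne, hev, hev]
  constructor
  · rintro ⟨h1, h2, h3, h4, h5⟩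
    refine ⟨fun f hf => ?_, h4, h5⟩
    have hd : IsUnit (ev (MvPolynomial.rename Subtype.val (MvPolynomial.X a * MvPolynomial.X b :
        MvPolynomial {k : Fin (n + 2) × Fin (m + 1) // freeFrom i m s l k.1 ≤ k.2} K))) := by
      rw [map_mul, map_mul, MvPolynomial.rename_X, MvPolynomial.rename_X, ha, hb, ← hA, ← hB,
        isUnit_iff_ne_zero]
      exact mul_ne_zero (by rwa [Ne, hev]) (by rwa [Ne, hev])
    -- ψ specializes the free parameters to their values at γ. The jets of ev and ψ ∘ θ then share
    -- all free coefficients, so uniqueness identifies them.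
    obtain ⟨ψ, hψ⟩ := exists_algHom_of_isUnit (P := P) ev hd
    have hfree : ∀ j r, freeFrom i m s l j ≤ r → PowerSeries.coeff r (evalJet ev j) =
        PowerSeries.coeff r (evalJet (ψ.comp θ) j) := by
      intro j r hr
      by_cases hrm : r < m + 1
      · have e1 := coeff_evalJet ev j ⟨r, hrm⟩
        have e2 := coeff_evalJet (ψ.comp θ) j ⟨r, hrm⟩
        simp only at e1 e2
        rw [e1, e2, AlgHom.comp_apply, hθ ⟨(j, ⟨r, hrm⟩), hr⟩, hψ, MvPolynomial.rename_X]
      · rw [coeff_evalJet_of_lt _ _ (by omega), coeff_evalJet_of_lt _ _ (by omega)]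
    have hcomp : ∀ j r, PowerSeries.coeff r (evalJet (ψ.comp θ) j) =
        ψ (PowerSeries.coeff r (x j)) := fun j r => by
      rw [coeff_evalJet_eq_jetCoeff, AlgHom.comp_apply, ← coeff_evalJet_eq_jetCoeff, hθx]
    have hmid : evalJet ev i.castSucc.succ = evalJet (ψ.comp θ) i.castSucc.succ := by
      ext r
      by_cases hr : r < s
      · rw [h2 r hr, hcomp, hx3 r hr, map_zero]
      · exact hfree _ _ (by rw [freeFrom_mid]; omega)
    have hright : evalJet ev i.succ.succ = evalJet (ψ.comp θ) i.succ.succ := by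
      ext r
      by_cases hr : r < l
      · rw [h3 r hr, hcomp, hx4 r hr, map_zero]
      · exact hfree _ _ (by rw [freeFrom_right]; omega)
    obtain ⟨U, hU⟩ := exists_eq_X_pow_mul_unit (PowerSeries.X_pow_dvd_iff.2 h2)
      (isUnit_iff_ne_zero.2 (by rwa [hevA, Ne, hev]))
    obtain ⟨V, hV⟩ := exists_eq_X_pow_mul_unit (PowerSeries.X_pow_dvd_iff.2 h3)
      (isUnit_iff_ne_zero.2 (by rwa [hevB, Ne, hev]))
    have hzero : ∀ g ∈ jetIdeal m (toricIdeal K u), (ψ.comp θ) g = 0 := fun g hg' => by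
      rw [AlgHom.comp_apply, (jetIdeal_le_ker_iff θ _).2 (by rwa [hθx]) g hg', map_zero]
    have heq := jet_unique hc hu (by omega) (by omega) h1
      ((jetIdeal_le_ker_iff (ψ.comp θ) _).1 hzero) hU (hmid ▸ hU) hV (hright ▸ hV) hfree
    have hev' : ev = ψ.comp θ := by
      apply MvPolynomial.algHom_ext
      intro k
      rw [← coeff_evalJet, heq, coeff_evalJet]
    rw [← hev, hev', AlgHom.comp_apply, (RingHom.mem_ker).1 hf, map_zero]
  · rintro ⟨h1, h2, h3⟩
    refine ⟨?_, fun r hr => ?_, fun r hr => ?_, h2, h3⟩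
    · rw [← jetIdeal_le_ker_iff]
      intro g hg'
      exact (hev g).2 (h1 ((jetIdeal_le_ker_iff θ _).2 (by rwa [hθx]) g hg'))
    · rw [coeff_evalJet_eq_jetCoeff, hev]
      refine h1 ?_
      rw [RingHom.mem_ker, ← coeff_evalJet_eq_jetCoeff, hθx, hx3 r hr]
    · rw [coeff_evalJet_eq_jetCoeff, hev]
      refine h1 ?_
      rw [RingHom.mem_ker, ← coeff_evalJet_eq_jetCoeff, hθx, hx4 r hr]

theorem card_not_free (hls : s + l ≤ m + 1) (hs : 1 ≤ s) (h2s : 2 * s ≤ m + 1) :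
    Nat.card {k : Fin (n + 2) × Fin (m + 1) // ¬ freeFrom i m s l k.1 ≤ k.2} =
      s * (n + 2) + (m - (2 * s - 1)) * (n + 2 - 2) := by
  rw [← sum_freeFrom i m s l hls hs h2s, Nat.card_eq_fintype_card, Fintype.card_subtype,
    ← Finset.univ_product_univ, Finset.card_filter, Finset.sum_product]
  refine Finset.sum_congr rfl fun j _ => ?_
  have hle : freeFrom i m s l j ≤ m + 1 := by
    unfold freeFrom
    split_ifs <;> omega
  rw [← Finset.card_filter]
  simp only [not_le]
  rw [Fin.card_filter_val_lt, min_eq_right hle]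

end Loci

end ToricJets

/-! ### Irreducibility, codimension and coordinate ring -/

theorem mainTheorem2 {K : Type*} [Field K] [IsAlgClosed K]
    (p q : ℕ) (hp : 0 < p) (hpq : p < q) (hcop : Nat.Coprime p q)
    (n : ℕ) (hn : 3 < n + 2) (c : Fin n → ℕ) (hc : ToricJets.IsHirzebruchJung p q c)
    (u : Fin (n + 2) → ℤ × ℤ) (hu : ToricJets.IsMinimalGenerators p q u)
    (i : Fin n) (m s l : ℕ) (hs : 1 ≤ s) (hsm : s ≤ ⌈(m : ℚ) / 2⌉₊)
    (hsl : s ≤ l) (hl : l ≤ min ((c i - 1) * s) (m + 1 - s)) :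
    (∃ h : IsIrreducible (ToricJets.C K u i m s l),
      ToricJets.codim
          (⟨ToricJets.C K u i m s l, h, isClosed_closure⟩ : TopologicalSpace.IrreducibleCloseds
            (PrimeSpectrum (ToricJets.JetRing K (n + 2) m))) =
        ((s * (n + 2) + (m - (2 * s - 1)) * (n + 2 - 2) : ℕ) : ℕ∞)) ∧
    ∃ (N : ℕ) (φ : ToricJets.coordRing K u i m s l ≃ₐ[K]
        MvPolynomial (Fin N) (ToricJets.TwoVarLoc K)),
      φ (ToricJets.restrict K u i m s l (ToricJets.coordA K i m s)) =
          MvPolynomial.C (algebraMap (MvPolynomial (Fin 2) K) _ (MvPolynomial.X 0)) ∧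
      φ (ToricJets.restrict K u i m s l (ToricJets.coordB K i m l)) =
          MvPolynomial.C (algebraMap (MvPolynomial (Fin 2) K) _ (MvPolynomial.X 1)) := by
  have h2s : 2 * s ≤ m + 1 := by
    have h1 : ⌈(m : ℚ) / 2⌉₊ ≤ (m + 1) / 2 := by
      rw [Nat.ceil_le, div_le_iff₀ (by norm_num)]
      have : m ≤ (m + 1) / 2 * 2 := by omega
      exact_mod_cast this
    omega
  obtain ⟨hlc, hls⟩ := le_min_iff.1 hl
  -- Extending by 2 keeps the recurrence convex at all indices; the vectors up to index n + 1 use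
  -- only the original entries.
  let c' : ℕ → ℕ := fun k => if h : k < n then c ⟨k, h⟩ else 2
  have hcc' : ∀ k : Fin n, c' k = c k := fun k => by simp [c']
  have hc' : ∀ k, 2 ≤ c' k := fun k => by
    simp only [c']
    split_ifs
    · exact hc.two_le _
    · exact le_rfl
  have hlast := ToricJets.hjSeq_last (by omega) hp (by omega) hcop hc hcc'
  have hu' := hu.eq_hjSeq hc' hlast
  have hne : ∀ k, u k ≠ 0 := by
    intro k hk
    have hdet := ToricJets.hjSeq_det c' k
    rw [← hu', hk] at hdet
    simp at hdet
  have hirr : ∀ α β : Fin (n + 2) →₀ ℕ, α.degree ≤ 1 →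
      ∑ k, α k • u k = ∑ k, β k • u k → α = β := fun α β h1 h2 =>
    hu.eq_of_sum_eq (by omega) hne h1 h2
  let F : Fin (n + 2) × Fin (m + 1) → Prop := fun k => ToricJets.freeFrom i m s l k.1 ≤ k.2
  let a : {k // F k} := ⟨(i.castSucc.succ, ⟨s, by omega⟩), (ToricJets.freeFrom_mid i m s l).le⟩
  let b : {k // F k} := ⟨(i.succ.succ, ⟨l, by omega⟩), (ToricJets.freeFrom_right i m s l).le⟩
  have hab : a ≠ b := fun h => by
    simpa [a, b, Fin.ext_iff] using congrArg (fun k => (k.1.1 : ℕ)) h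
  obtain ⟨N, _, _, hloc, hPa, hPb⟩ := ToricJets.exists_isLocalization_mvPolynomial K hab
  have : IsDomain (ToricJets.TwoVarLoc K) := IsLocalization.isDomain_localization
    (powers_le_nonZeroDivisors_of_noZeroDivisors
      (mul_ne_zero (MvPolynomial.X_ne_zero _) (MvPolynomial.X_ne_zero _)))
  obtain ⟨θ, hθ, hD⟩ := ToricJets.exists_parametrization (K := K) (i := i) hc' hu' hirr h2s hsl
    (by rwa [hcc']) (by omega) (by omega) (a := a) (b := b) rfl rfl
    (P := MvPolynomial (Fin N) (ToricJets.TwoVarLoc K))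
  have hA : ToricJets.coordA K i m s = MvPolynomial.X (a : Fin (n + 2) × Fin (m + 1)) :=
    ToricJets.jetCoeff_X _ (⟨s, by omega⟩ : Fin (m + 1))
  have hB : ToricJets.coordB K i m l = MvPolynomial.X (b : Fin (n + 2) × Fin (m + 1)) :=
    ToricJets.jetCoeff_X _ (⟨l, by omega⟩ : Fin (m + 1))
  have hAB : ToricJets.coordA K i m s * ToricJets.coordB K i m l =
      MvPolynomial.rename Subtype.val (MvPolynomial.X a * MvPolynomial.X b) := by
    rw [hA, hB, map_mul, MvPolynomial.rename_X, MvPolynomial.rename_X]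
  have hprime : (RingHom.ker θ).IsPrime := RingHom.ker_isPrime _
  have hnot : ToricJets.coordA K i m s * ToricJets.coordB K i m l ∉ RingHom.ker θ := by
    rw [hAB, RingHom.mem_ker, ToricJets.apply_rename_val hθ]
    exact (IsLocalization.Away.algebraMap_isUnit (MvPolynomial.X a * MvPolynomial.X b)).ne_zero
  have hC : ToricJets.C K u i m s l = PrimeSpectrum.zeroLocus (RingHom.ker θ) :=
    ToricJets.closure_eq_zeroLocus hnot hD
  constructor
  · have hI : IsIrreducible (ToricJets.C K u i m s l) := by
      rw [hC, PrimeSpectrum.isIrreducible_zeroLocus_iff_of_radical _ hprime.isRadical]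
      exact hprime
    refine ⟨hI, ?_⟩
    refine (ToricJets.codim_eq_height hC hI isClosed_closure).trans ?_
    rw [← ToricJets.card_not_free (i := i) (l := l) (by omega) hs h2s]
    exact le_antisymm (ToricJets.height_ker_le (d := MvPolynomial.X a * MvPolynomial.X b) hθ)
      (ToricJets.le_height_ker (d := MvPolynomial.X a * MvPolynomial.X b) hθ)
  · obtain ⟨φ, hφ⟩ := ToricJets.exists_algEquiv_localization
      (d := MvPolynomial.X a * MvPolynomial.X b) hθ
      (ToricJets.vanishingIdeal_eq hnot hD) hAB
    refine ⟨N, φ, ?_, ?_⟩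
    · rw [← hPa, ← hθ, ← hA]
      exact hφ _
    · rw [← hPb, ← hθ, ← hB]
      exact hφ _
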